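/- Let $m\ge 1$, let $\gamma=(\gamma_1,\dots,\gamma_m)$ be integers with $\gamma_i\ge 2$ for all $i$, and let $d=\gamma_1+\dots+\gamma_m$, so that $\mathbb R^d=\mathbb R^{\gamma_1}\times\dots\times\mathbb R^{\gamma_m}$ and $d\ge 2$. Let $SO(\gamma)=SO(\gamma_1)\times\dots\times SO(\gamma_m)$ act blockwise on $\mathbb R^d$. For $x=(\tilde x_1,\dots,\tilde x_m)\in\mathbb R^d$ put $r(x)=(|\tilde x_1|,\dots,|\tilde x_m|)$. Let $H_\gamma\subset\mathbb R^d$ be the $m$-dimensional subspace of the points $(\tilde r_1,\dots,\tilde r_m)$ with $\tilde r_j=(r_j,0,\dots,0)\in\mathbb R^{\gamma_j}$, $r_j\in\mathbb R$; it is identified with $\mathbb R^m$ through $(r_1,\dots,r_m)$. Let $G=G(\gamma)$ be the finite group of all sign changes $(r_1,\dots,r_m)\mapsto(\pm r_1,\dots,\pm r_m)$ on $H_\gamma$, and let $w_\gamma(r_1,\dots,r_m)=\prod_{i=1}^m|r_i|^{\gamma_i-1}$. For a weight $w$ on $\mathbb R^n$, $s\in\mathbb R$ and $0<q\le\infty$,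 the Besov space $B^s_{\infty,q}(\mathbb R^n,w)$ consists of all complex tempered distributions $f$ on $\mathbb R^n$ with $$\|f\,|\,B^s_{\infty,q}(\mathbb R^n,w)\|=\Big\|\big(2^{js}\,\|\mathcal F^{-1}(\varphi_j\mathcal F f)\,|\,L_\infty(\mathbb R^n,w)\|\big)_{j\ge 0}\,\Big|\,\ell_q\Big\|<\infty,$$ where $\varphi_0\in\mathcal S(\mathbb R^n)$, $\varphi_0(\xi)=1$ for $|\xi|\le 1$, $\varphi_0(\xi)=0$ for $|\xi|\ge 3/2$, $\varphi_j(\xi)=\varphi_0(2^{-j}\xi)-\varphi_0(2^{-j+1}\xi)$ for $j\ge 1$, and $L_\infty(\mathbb R^n,w)$ is the $L_\infty$-space of the measure $w\,dx$; $B^s_{\infty,q}(\mathbb R^n)$ is the case $w=1$. Let $R_\gamma B^s_{\infty,q}(\mathbb R^d)$ be the subspace of the $SO(\gamma)$-invariant elements of $B^s_{\infty,q}(\mathbb R^d)$, and $R_GB^s_{\infty,q}(H_\gamma,w_\gamma)$ the subspace of the $G$-invariant elements of $B^s_{\infty,q}(\mathbb R^m,w_\gamma)$. **Proposition.** Let $0<s<1$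 and $0<q\le\infty$. Every element of $R_\gamma B^s_{\infty,q}(\mathbb R^d)$ and every element of $R_GB^s_{\infty,q}(H_\gamma,w_\gamma)$ has a (unique) continuous representative, and, with these representatives, the restriction map $$\operatorname{tr}f\,(r_1,\dots,r_m)=f(\tilde r_1,\dots,\tilde r_m)$$ is a linear isomorphism of $R_\gamma B^s_{\infty,q}(\mathbb R^d)$ onto $R_GB^s_{\infty,q}(H_\gamma,w_\gamma)$, bounded in both directions with respect to the Besov (quasi-)norms, whose inverse is the map $\operatorname{ext}g\,(x)=g(r(x))$. -/

import Mathlib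

open MeasureTheory
open scoped SchwartzMap ENNReal NNReal

noncomputable section

namespace BlockRadial

section Distributions

variable {E : Type*} [NormedAddCommGroup E] [InnerProductSpace ℝ E] [FiniteDimensional ℝ E]
  [MeasurableSpace E] [BorelSpace E]

/-- The tempered distribution `T` is regular and given by the function `F`, i.e.
`T u = ∫ u F` with an absolutely convergent integral for every Schwartz function `u`. -/
def Represents (F : E → ℂ) (T : 𝓢'(E, ℂ)) : Prop :=
  AEStronglyMeasurable F volume ∧
    ∀ u : 𝓢(E, ℂ), Integrable (fun x => u x * F x) volume ∧ T u = ∫ x, u x * F x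

/-- The weighted (quasi-)norm `‖T | L_p(w)‖` of a tempered distribution: the `L_p`-norm, with
respect to the measure `w dx`, of the function that represents `T` (this function is unique
almost everywhere), and `∞` if `T` is not a regular distribution. -/
def distLpNorm (w : E → ℝ≥0∞) (p : ℝ≥0∞) (T : 𝓢'(E, ℂ)) : ℝ≥0∞ :=
  ⨅ F : {F : E → ℂ // Represents F T}, eLpNorm F.1 p (volume.withDensity w)

/-- A generator `φ₀` of a smooth dyadic resolution of unity: a Schwartz function which is `1` for
`|ξ| ≤ 1` and `0` for `|ξ| ≥ 3/2`. -/
def IsDyadicGenerator (φ : 𝓢(E, ℂ)) : Prop :=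
  (∀ ξ, ‖ξ‖ ≤ 1 → φ ξ = 1) ∧ ∀ ξ, 3 / 2 ≤ ‖ξ‖ → φ ξ = 0

/-- The smooth dyadic resolution of unity generated by `φ₀`:
`φ_j(ξ) = φ₀(2^{-j} ξ) - φ₀(2^{-j+1} ξ)` for `j ≥ 1`. -/
def dyadicPiece (φ : 𝓢(E, ℂ)) : ℕ → E → ℂ
  | 0 => fun ξ => φ ξ
  | j + 1 => fun ξ => φ (((2 : ℝ) ^ (j + 1))⁻¹ • ξ) - φ (((2 : ℝ) ^ j)⁻¹ • ξ)

/-- The weighted Besov (quasi-)norm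
`‖f | B^s_{p,q}(w)‖ = ‖ (2^{js} ‖𝓕⁻¹(φ_j 𝓕 f) | L_p(w)‖)_{j ≥ 0} | ℓ_q ‖`. -/
def besovNorm (φ : 𝓢(E, ℂ)) (w : E → ℝ≥0∞) (s : ℝ) (p q : ℝ≥0∞) (f : 𝓢'(E, ℂ)) : ℝ≥0∞ :=
  eLpNorm (fun j : ℕ => (2 : ℝ≥0∞) ^ ((j : ℝ) * s) *
    distLpNorm w p (TemperedDistribution.fourierMultiplierCLM ℂ (dyadicPiece φ j) f))
    q Measure.count

theorem Represents.add {F G : E → ℂ} {S T : 𝓢'(E, ℂ)} (hF : Represents F S)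
    (hG : Represents G T) : Represents (F + G) (S + T) := by
  refine ⟨hF.1.add hG.1, fun u => ?_⟩
  have h1 := hF.2 u
  have h2 := hG.2 u
  have e : (fun x => u x * (F + G) x) = fun x => u x * F x + u x * G x := by
    funext x; simp [mul_add]
  rw [e]
  refine ⟨h1.1.add h2.1, ?_⟩
  rw [integral_add h1.1 h2.1, ← h1.2, ← h2.2]
  rfl

theorem Represents.smul {F : E → ℂ} {T : 𝓢'(E, ℂ)} (c : ℂ) (hF : Represents F T) :
    Represents (c • F) (c • T) := by
  refine ⟨hF.1.const_smul c, fun u => ?_⟩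
  have h1 := hF.2 u
  have e : (fun x => u x * (c • F) x) = fun x => c * (u x * F x) := by
    funext x; simp; ring
  rw [e]
  refine ⟨h1.1.const_mul c, ?_⟩
  rw [integral_const_mul, ← h1.2]
  rfl

theorem represents_zero : Represents (0 : E → ℂ) (0 : 𝓢'(E, ℂ)) := by
  refine ⟨aestronglyMeasurable_const, fun u => ?_⟩
  simp

theorem distLpNorm_zero (w : E → ℝ≥0∞) (p : ℝ≥0∞) : distLpNorm w p (0 : 𝓢'(E, ℂ)) = 0 := by
  refine le_antisymm ?_ bot_le
  refine (iInf_le _ ⟨0, represents_zero⟩).trans ?_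
  simp

theorem distLpNorm_add_le (w : E → ℝ≥0∞) (p : ℝ≥0∞) (S T : 𝓢'(E, ℂ)) :
    distLpNorm w p (S + T) ≤
      ENNReal.ofNNReal (ENNReal.LpAddConst p).toNNReal * (distLpNorm w p S + distLpNorm w p T) := by
  have hne : ENNReal.LpAddConst p ≠ ∞ := (ENNReal.LpAddConst_lt_top p).ne
  rw [ENNReal.coe_toNNReal hne, mul_add]
  by_cases h0 : ENNReal.LpAddConst p = 0
  · exfalso
    unfold ENNReal.LpAddConst at h0
    split_ifs at h0 <;> simp at h0
  unfold distLpNorm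
  rw [ENNReal.mul_iInf_of_ne h0 hne, ENNReal.mul_iInf_of_ne h0 hne]
  refine ENNReal.le_iInf_add_iInf fun F G => ?_
  refine (iInf_le _ ⟨F.1 + G.1, F.2.add G.2⟩).trans ?_
  rw [← mul_add]
  have hac := withDensity_absolutelyContinuous (volume : Measure E) w
  exact eLpNorm_add_le' (F.2.1.mono_ac hac) (G.2.1.mono_ac hac) p

theorem distLpNorm_smul_le (w : E → ℝ≥0∞) (p : ℝ≥0∞) (c : ℂ) (T : 𝓢'(E, ℂ)) :
    distLpNorm w p (c • T) ≤ ‖c‖ₑ * distLpNorm w p T := by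
  by_cases hc : c = 0
  · subst hc
    rw [show (0 : ℂ) • T = 0 from zero_smul ℂ T, distLpNorm_zero]
    exact bot_le
  unfold distLpNorm
  rw [ENNReal.mul_iInf_of_ne (by simpa using hc) (by simp)]
  refine le_iInf fun F => ?_
  refine (iInf_le _ ⟨c • F.1, F.2.smul c⟩).trans ?_
  exact eLpNorm_const_smul_le

/-- The weighted Besov space `B^s_{p,q}(w)`: all tempered distributions with finite Besov
(quasi-)norm. -/
def besovSpace (φ : 𝓢(E, ℂ)) (w : E → ℝ≥0∞) (s : ℝ) (p q : ℝ≥0∞) :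
    Submodule ℂ 𝓢'(E, ℂ) where
  carrier := {f | besovNorm φ w s p q f < ∞}
  zero_mem' := by
    simp [besovNorm, distLpNorm_zero]
  add_mem' := by
    intro f g hf hg
    have hm : ∀ a : ℕ → ℝ≥0∞, AEStronglyMeasurable a (Measure.count : Measure ℕ) :=
      fun a => (measurable_of_countable a).aestronglyMeasurable
    have h := (eLpNorm_add_lt_top (μ := (Measure.count : Measure ℕ)) ⟨hm _, hf⟩ ⟨hm _, hg⟩)
    refine lt_of_le_of_lt
      (eLpNorm_le_nnreal_smul_eLpNorm_of_ae_le_mul' (c := (ENNReal.LpAddConst p).toNNReal) ?_ q)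
      (ENNReal.mul_lt_top ENNReal.coe_lt_top h)
    refine Filter.Eventually.of_forall fun j => ?_
    simp only [enorm_eq_self, map_add, Pi.add_apply]
    rw [← mul_add, mul_left_comm]
    exact mul_le_mul_right (distLpNorm_add_le w p _ _) _
  smul_mem' := by
    intro c f hf
    refine lt_of_le_of_lt
      (eLpNorm_le_nnreal_smul_eLpNorm_of_ae_le_mul' (c := ‖c‖₊) ?_ q)
      (ENNReal.mul_lt_top ENNReal.coe_lt_top hf)
    refine Filter.Eventually.of_forall fun j => ?_
    simp only [enorm_eq_self, map_smul]
    rw [mul_left_comm]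
    exact mul_le_mul_right (distLpNorm_smul_le w p c _) _

/-- The tempered distributions that are invariant under all isometries in `S`. -/
def invariantDistributions (S : Set (E ≃ₗᵢ[ℝ] E)) : Submodule ℂ 𝓢'(E, ℂ) where
  carrier := {f | ∀ A ∈ S, ∀ u : 𝓢(E, ℂ),
    f (SchwartzMap.compCLMOfContinuousLinearEquiv ℂ A.toContinuousLinearEquiv u) = f u}
  zero_mem' := fun _ _ _ => rfl
  add_mem' := fun hf hg A hA u => congrArg₂ (· + ·) (hf A hA u) (hg A hA u)
  smul_mem' := fun c _ hf A hA u => congrArg (c • ·) (hf A hA u)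

end Distributions

section Blocks

variable {m : ℕ} (γ : Fin m → ℕ)

/-- `ℝ^d = ℝ^{γ₁} × ⋯ × ℝ^{γ_m}`, `d = γ₁ + ⋯ + γ_m`, with its Euclidean norm; the coordinate
`x ⟨i, k⟩` is the `k`-th coordinate (counted from `0`) in the `i`-th block. -/
abbrev BlockSpace : Type := EuclideanSpace ℝ (Σ i : Fin m, Fin (γ i))

/-- The group `SO(γ) = SO(γ₁) × ⋯ × SO(γ_m)` acting blockwise on `ℝ^d`. -/
def blockRotations : Set (BlockSpace γ ≃ₗᵢ[ℝ] BlockSpace γ) :=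
  {A | ∃ g : ∀ i : Fin m, Matrix.specialOrthogonalGroup (Fin (γ i)) ℝ,
    ∀ (x : BlockSpace γ) (i : Fin m) (k : Fin (γ i)),
      A x ⟨i, k⟩ = ∑ l, (g i : Matrix (Fin (γ i)) (Fin (γ i)) ℝ) k l * x ⟨i, l⟩}

/-- The group `G(γ)` of all sign changes `(r₁, …, r_m) ↦ (±r₁, …, ±r_m)` on `ℝ^m`. -/
def signChanges (m : ℕ) : Set (EuclideanSpace ℝ (Fin m) ≃ₗᵢ[ℝ] EuclideanSpace ℝ (Fin m)) :=
  {A | ∃ ε : Fin m → ℤˣ, ∀ (r : EuclideanSpace ℝ (Fin m)) (i : Fin m),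
    A r i = ((ε i : ℤ) : ℝ) * r i}

/-- The identification of `r ∈ ℝ^m` with the point `(r̃₁, …, r̃_m)` of the plane `H_γ ⊆ ℝ^d`,
where `r̃_j = (r_j, 0, …, 0) ∈ ℝ^{γ_j}`. -/
def toPlane (r : EuclideanSpace ℝ (Fin m)) : BlockSpace γ :=
  WithLp.toLp 2 fun ik => if (ik.2 : ℕ) = 0 then r ik.1 else 0

/-- The vector `r(x) = (r₁(x), …, r_m(x))` of the Euclidean norms of the blocks of `x`. -/
def blockRadii (x : BlockSpace γ) : EuclideanSpace ℝ (Fin m) :=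
  WithLp.toLp 2 fun i => √(∑ k, x ⟨i, k⟩ ^ 2)

/-- The weight `w_γ(r) = ∏ |r_i|^{γ_i - 1}` on `H_γ = ℝ^m`. -/
def weight (r : EuclideanSpace ℝ (Fin m)) : ℝ≥0∞ :=
  ENNReal.ofReal (∏ i, |r i| ^ (γ i - 1))

/-- `g = tr f`: the distribution `f` has a continuous representative `F` (necessarily unique),
and `g` is given by the restriction `r ↦ F(r̃₁, …, r̃_m)` of `F` to `H_γ`. -/
def IsTrace (f : 𝓢'(BlockSpace γ, ℂ)) (g : 𝓢'(EuclideanSpace ℝ (Fin m), ℂ)) : Prop :=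
  ∃ F : BlockSpace γ → ℂ, Continuous F ∧ Represents F f ∧
    Represents (fun r => F (toPlane γ r)) g

/-- `f = ext g`: the distribution `g` has a continuous representative `G` (necessarily unique),
and `f` is given by the function `x ↦ G(r₁(x), …, r_m(x))`. -/
def IsExtension (g : 𝓢'(EuclideanSpace ℝ (Fin m), ℂ)) (f : 𝓢'(BlockSpace γ, ℂ)) : Prop :=
  ∃ G : EuclideanSpace ℝ (Fin m) → ℂ, Continuous G ∧ Represents G g ∧
    Represents (fun x => G (blockRadii γ x)) f

/-- The space `R_γ B^s_{p,q}(ℝ^d)` of `SO(γ)`-invariant elements of the unweighted Besov space. -/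
def blockRadialBesov (φ : 𝓢(BlockSpace γ, ℂ)) (s : ℝ) (p q : ℝ≥0∞) :
    Submodule ℂ 𝓢'(BlockSpace γ, ℂ) :=
  invariantDistributions (blockRotations γ) ⊓ besovSpace φ (fun _ => 1) s p q

/-- The space `R_G B^s_{p,q}(H_γ, w_γ)` of `G(γ)`-invariant elements of the weighted Besov
space. -/
def reflectionInvariantBesov (ψ : 𝓢(EuclideanSpace ℝ (Fin m), ℂ)) (s : ℝ) (p q : ℝ≥0∞) :
    Submodule ℂ 𝓢'(EuclideanSpace ℝ (Fin m), ℂ) :=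
  invariantDistributions (signChanges m) ⊓ besovSpace ψ (weight γ) s p q

end Blocks

end BlockRadial

end

/-!
For `p = ∞` the weight is irrelevant: it vanishes only on a null set, so `L_∞(w_γ)` is `L_∞`. The
statement therefore compares two unweighted spaces `B^s_{∞,q}`, on `ℝ^d` and on `ℝ^m`. For
`0 < s < 1` the norm of such a space is equivalent to an expression in first order differences
(`modulusNorm`), the `ℓ_q`-norm of `2^{js} a_j` with `a_0 = sup |F|` and
`a_j = sup {|F x - F y| : |x - y| ≤ 2^{-j}}`. This expression does not increase under composition
with nonexpansive maps (`modulusNorm_comp_le`), and both `r ↦ (r̃₁, …, r̃_m)` and the block radii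
`x ↦ r(x)` are nonexpansive. This gives the boundedness of trace and extension
(`exists_besovNorm_trace_le`, `exists_besovNorm_extension_le`).

The equivalence of norms has two halves.

* `exists_besovNorm_le_modulusNorm`: for `j ≥ 1`, the `j`-th dyadic piece of a bounded continuous
  `F` is the difference of two convolutions of `F` with kernels of integral one at the scales
  `2^{-j}` and `2^{-j+1}`, each of which differs from `F` by at most a multiple of `a_j`.
* `exists_continuous_represents_modulusNorm_le`: let `b_j` be the `L_∞`-norm of the `j`-th dyadic
  piece of `f`. The piece is reproduced by convolution with a kernel at the scale `2^{-(j+1)}`;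
  hence it is a continuous function of size at most `C b_j` and Lipschitz constant at most
  `C 2^j b_j`. As `s > 0`, the pieces can be summed uniformly, and the sum is a continuous
  representative of `f`. Its increments over distances up to `2^{-k}` are at most
  `C ∑_j min(1, 2^{j-k}) b_j`, and for `0 < s < 1` the discrete Hardy inequality
  `exists_eLpNorm_tsum_pow_dist_le` bounds the resulting weighted `ℓ_q`-norm by that of `(b_j)`.

A continuous representative is unique, so it inherits the symmetries of the distribution
(`apply_eq_of_mem_invariantDistributions`). Since `SO(n)`, `n ≥ 2`, acts transitively on spheres,
every orbit of `SO(γ)` meets `H_γ` in the point of the block radii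
(`exists_blockRotation_eq_toPlane`), so that an invariant function is the extension of its
restriction. Conversely, a function that is even in each variable is the restriction of its
extension.
-/

/-! ### Regular distributions and their representatives -/

namespace BlockRadial

section Distributions

variable {E : Type*} [NormedAddCommGroup E] [InnerProductSpace ℝ E] [FiniteDimensional ℝ E]
  [MeasurableSpace E] [BorelSpace E]

theorem Represents.sub {F G : E → ℂ} {S T : 𝓢'(E, ℂ)} (hF : Represents F S)
    (hG : Represents G T) : Represents (F - G) (S - T) := by
  have e1 : F - G = F + (-1 : ℂ) • G := by simp [sub_eq_add_neg]
  have e2 : S - T = S + (-1 : ℂ) • T := by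
    ext u
    change S u - T u = S u + (-1) * T u
    ring
  rw [e1, e2]
  exact hF.add (hG.smul (-1))

theorem Represents.sum {ι : Type*} (t : Finset ι) {F : ι → E → ℂ} {T : ι → 𝓢'(E, ℂ)}
    (h : ∀ i ∈ t, Represents (F i) (T i)) : Represents (∑ i ∈ t, F i) (∑ i ∈ t, T i) := by
  classical
  induction t using Finset.induction_on with
  | empty => simpa using represents_zero
  | insert a t ha ih =>
    rw [Finset.sum_insert ha, Finset.sum_insert ha]
    exact (h a (by simp)).add (ih fun i hi => h i (by simp [hi]))

theorem Represents.dist_ext {F : E → ℂ} {S T : 𝓢'(E, ℂ)} (hS : Represents F S)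
    (hT : Represents F T) : S = T := by
  ext u
  rw [(hS.2 u).2, (hT.2 u).2]

theorem Represents.locallyIntegrable {F : E → ℂ} {T : 𝓢'(E, ℂ)} (hF : Represents F T) :
    LocallyIntegrable F volume := by
  rw [locallyIntegrable_iff]
  intro K hK
  obtain ⟨R, hR⟩ := hK.isBounded.subset_closedBall (0 : E)
  let b : ContDiffBump (0 : E) := ⟨max R 1, max R 1 + 1, by positivity, by linarith⟩
  have h1 : HasCompactSupport (Complex.ofRealCLM ∘ b) := b.hasCompactSupport.comp_left rfl
  have h2 : ContDiff ℝ ((⊤ : ℕ∞) : WithTop ℕ∞) (Complex.ofRealCLM ∘ b) :=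
    Complex.ofRealCLM.contDiff.comp b.contDiff
  refine ((hF.2 (h1.toSchwartzMap h2)).1.integrableOn (s := K)).congr_fun_ae ?_
  filter_upwards [ae_restrict_mem hK.measurableSet] with x hx
  have : b x = 1 := b.one_of_mem_closedBall (Metric.closedBall_subset_closedBall
    (le_max_left _ _) (hR hx))
  simp [this]

/-- The function representing a regular distribution is unique almost everywhere. -/
theorem Represents.ae_eq {F G : E → ℂ} {T : 𝓢'(E, ℂ)} (hF : Represents F T)
    (hG : Represents G T) : F =ᵐ[volume] G := by
  have h0 : Represents (F - G) (0 : 𝓢'(E, ℂ)) := by simpa using hF.sub hG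
  have h := ae_eq_zero_of_integral_contDiff_smul_eq_zero h0.locallyIntegrable fun g hg hc => by
    have h1 : HasCompactSupport (Complex.ofRealCLM ∘ g) := hc.comp_left rfl
    have h2 : ContDiff ℝ ((⊤ : ℕ∞) : WithTop ℕ∞) (Complex.ofRealCLM ∘ g) :=
      Complex.ofRealCLM.contDiff.comp hg
    have := (h0.2 (h1.toSchwartzMap h2)).2
    simpa using this.symm
  filter_upwards [h] with x hx
  exact sub_eq_zero.mp hx

theorem Represents.eq_of_continuous {F G : E → ℂ} {T : 𝓢'(E, ℂ)} (hF : Represents F T)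
    (hG : Represents G T) (cF : Continuous F) (cG : Continuous G) : F = G :=
  (cF.ae_eq_iff_eq volume cG).mp (hF.ae_eq hG)

theorem distLpNorm_eq {F : E → ℂ} {T : 𝓢'(E, ℂ)} (hF : Represents F T) (w : E → ℝ≥0∞)
    (p : ℝ≥0∞) : distLpNorm w p T = eLpNorm F p (volume.withDensity w) := by
  refine le_antisymm (iInf_le _ (⟨F, hF⟩ : {F : E → ℂ // Represents F T})) (le_iInf fun G => ?_)
  exact (eLpNorm_congr_ae ((withDensity_absolutelyContinuous _ w).ae_eq (hF.ae_eq G.2))).le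

theorem distLpNorm_top_le {F : E → ℂ} {T : 𝓢'(E, ℂ)} (hF : Represents F T) (w : E → ℝ≥0∞)
    {B : ℝ≥0∞} (hB : ∀ x, ‖F x‖ₑ ≤ B) : distLpNorm w ∞ T ≤ B := by
  rw [distLpNorm_eq hF, eLpNorm_exponent_top]
  exact eLpNormEssSup_le_of_ae_enorm_bound (Filter.Eventually.of_forall hB)

/-- A distribution of finite weighted `L_∞`-norm is a bounded function; the weight plays no role,
provided that it does not vanish on a set of positive measure. -/
theorem exists_represents_of_distLpNorm_lt_top {w : E → ℝ≥0∞}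
    (hw : (volume : Measure E) ≪ volume.withDensity w) {T : 𝓢'(E, ℂ)}
    (hT : distLpNorm w ∞ T < ∞) :
    ∃ F : E → ℂ, Represents F T ∧ ∀ᵐ x, ‖F x‖ ≤ (distLpNorm w ∞ T).toReal := by
  obtain ⟨F, -⟩ := iInf_lt_iff.mp hT
  refine ⟨F.1, F.2, ?_⟩
  have h : eLpNormEssSup F.1 volume ≤ distLpNorm w ∞ T := by
    rw [distLpNorm_eq F.2, eLpNorm_exponent_top]
    exact eLpNormEssSup_mono_measure _ hw
  filter_upwards [ae_le_eLpNormEssSup (f := F.1) (μ := volume)] with x hx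
  rw [← toReal_enorm]
  exact ENNReal.toReal_mono hT.ne (hx.trans h)

theorem integrable_schwartz_mul (u : 𝓢(E, ℂ)) {F : E → ℂ} (hF : AEStronglyMeasurable F volume)
    {M : ℝ} (hM : ∀ᵐ x, ‖F x‖ ≤ M) : Integrable (fun x => u x * F x) volume :=
  u.integrable.mul_bdd hF hM

theorem exists_represents_of_bounded {F : E → ℂ} (hF : AEStronglyMeasurable F volume)
    {M : ℝ} (hM : ∀ᵐ x, ‖F x‖ ≤ M) : ∃ T : 𝓢'(E, ℂ), Represents F T := by
  have hL : MemLp F ∞ volume := memLp_top_of_bound hF M hM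
  refine ⟨(hL.toLp F : Lp ℂ ∞ (volume : Measure E)), hF, fun u =>
    ⟨integrable_schwartz_mul u hF hM, ?_⟩⟩
  rw [Lp.toTemperedDistribution_apply]
  refine integral_congr_ae ?_
  filter_upwards [hL.coeFn_toLp] with x hx
  rw [hx, smul_eq_mul]

theorem integral_comp_isometry_mul (A : E ≃ₗᵢ[ℝ] E) (u : 𝓢(E, ℂ)) (F : E → ℂ) :
    ∫ x, SchwartzMap.compCLMOfContinuousLinearEquiv ℂ A.toContinuousLinearEquiv u x * F (A x)
      = ∫ x, u x * F x := by
  simpa using A.measurePreserving.integral_comp A.toHomeomorph.measurableEmbedding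
    (fun x => u x * F x)

/-- The continuous representative of an invariant distribution is an invariant function. -/
theorem apply_eq_of_mem_invariantDistributions {S : Set (E ≃ₗᵢ[ℝ] E)} {T : 𝓢'(E, ℂ)}
    (hT : T ∈ invariantDistributions S) {F : E → ℂ} (hF : Represents F T) (cF : Continuous F)
    {M : ℝ} (hM : ∀ x, ‖F x‖ ≤ M) {A : E ≃ₗᵢ[ℝ] E} (hA : A ∈ S) (x : E) : F (A x) = F x := by
  have cA : Continuous fun x => F (A x) := cF.comp A.continuous
  obtain ⟨T', hT'⟩ := exists_represents_of_bounded (M := M) cA.aestronglyMeasurable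
    (Filter.Eventually.of_forall fun x => hM (A x))
  have e : T' = T := by
    ext u
    rw [(hT'.2 u).2, (hF.2 u).2]
    have h := hT A hA (SchwartzMap.compCLMOfContinuousLinearEquiv ℂ
      A.symm.toContinuousLinearEquiv u)
    rw [(hF.2 _).2, (hF.2 _).2] at h
    rw [← (A.symm).measurePreserving.integral_comp A.symm.toHomeomorph.measurableEmbedding]
    simp only [LinearIsometryEquiv.apply_symm_apply]
    rw [show (∫ x, u (A.symm x) * F x) = _ from h.symm]
    simp
  subst e
  exact congrFun (hT'.eq_of_continuous hF cA cF) x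

theorem mem_invariantDistributions_of_apply_eq {S : Set (E ≃ₗᵢ[ℝ] E)} {T : 𝓢'(E, ℂ)}
    {F : E → ℂ} (hF : Represents F T) (h : ∀ A ∈ S, ∀ x, F (A x) = F x) :
    T ∈ invariantDistributions S := by
  intro A hA u
  rw [(hF.2 _).2, (hF.2 _).2, ← integral_comp_isometry_mul A u F]
  simp only [h A hA]

end Distributions

end BlockRadial

/-! ### A discrete Hardy inequality -/

namespace BlockRadial

theorem tsum_pow_dist_le {θ : ℝ≥0∞} (hθ : θ ≤ 1) (j : ℕ) :
    ∑' k : ℕ, θ ^ Nat.dist k j ≤ 2 * (1 - θ)⁻¹ := by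
  rw [← ENNReal.summable.sum_add_tsum_nat_add' (k := j), two_mul]
  refine add_le_add ?_ ?_
  · rw [← ENNReal.tsum_geometric θ, ← Finset.sum_range_reflect]
    refine le_trans (Finset.sum_le_sum fun i hi => ?_) (ENNReal.sum_le_tsum (Finset.range j))
    have hi' : i < j := Finset.mem_range.mp hi
    rw [show Nat.dist (j - 1 - i) j = i + 1 by rw [Nat.dist]; omega]
    exact pow_le_pow_right_of_le_one' hθ i.le_succ
  · rw [← ENNReal.tsum_geometric θ]
    refine ENNReal.tsum_le_tsum fun i => ?_
    rw [show Nat.dist (i + j) j = i by rw [Nat.dist]; omega]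

/-- The sum over `j` is replaced by a supremum at the price of half of the geometric decay; this
treats all exponents `0 < q ≤ ∞` alike. -/
theorem tsum_sq_pow_dist_mul_le {θ : ℝ≥0∞} (hθ : θ ≤ 1) (β : ℕ → ℝ≥0∞) (k : ℕ) :
    ∑' j, (θ ^ 2) ^ Nat.dist k j * β j ≤
      2 * (1 - θ)⁻¹ * ⨆ j, θ ^ Nat.dist k j * β j := by
  calc ∑' j, (θ ^ 2) ^ Nat.dist k j * β j
      ≤ ∑' j, θ ^ Nat.dist j k * ⨆ i, θ ^ Nat.dist k i * β i := by
        refine ENNReal.tsum_le_tsum fun j => ?_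
        rw [pow_right_comm, sq, mul_assoc, Nat.dist_comm j k]
        gcongr
        exact le_iSup (fun i => θ ^ Nat.dist k i * β i) j
    _ ≤ _ := by
        rw [ENNReal.tsum_mul_right]
        gcongr
        exact tsum_pow_dist_le hθ k

/-- Discrete Hardy inequality: convolution with a two-sided geometric sequence is bounded on
`ℓ_q`, `0 < q ≤ ∞`. -/
theorem exists_eLpNorm_tsum_pow_dist_le {ρ : ℝ≥0∞} (hρ : ρ < 1) {q : ℝ≥0∞} (hq : 0 < q) :
    ∃ C : ℝ≥0, ∀ β : ℕ → ℝ≥0∞,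
      eLpNorm (fun k => ∑' j, ρ ^ Nat.dist k j * β j) q Measure.count ≤
        C * eLpNorm β q Measure.count := by
  obtain ⟨θ, hθ, rfl⟩ : ∃ θ : ℝ≥0∞, θ < 1 ∧ ρ = θ ^ 2 := by
    refine ⟨ρ ^ (1 / 2 : ℝ), ENNReal.rpow_lt_one hρ (by norm_num), ?_⟩
    rw [← ENNReal.rpow_natCast, ← ENNReal.rpow_mul]
    norm_num
  have fin : ∀ t : ℝ≥0∞, t < 1 → 2 * (1 - t)⁻¹ ≠ ∞ := fun t ht =>
    ENNReal.mul_ne_top (by simp) (ENNReal.inv_ne_top.mpr (tsub_pos_of_lt ht).ne')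
  set M : ℝ≥0∞ := 2 * (1 - θ)⁻¹ with hM
  by_cases hq' : q = ∞
  · subst hq'
    refine ⟨M.toNNReal, fun β => ?_⟩
    rw [ENNReal.coe_toNNReal (fin θ hθ), eLpNorm_exponent_top, eLpNorm_exponent_top,
      eLpNormEssSup_count, eLpNormEssSup_count]
    refine iSup_le fun k => ?_
    simp only [enorm_eq_self]
    refine (tsum_sq_pow_dist_mul_le hθ.le β k).trans ?_
    gcongr with j
    exact mul_le_of_le_one_left' (pow_le_one' hθ.le _)
  · set p : ℝ := q.toReal with hp
    have hp0 : 0 < p := ENNReal.toReal_pos hq.ne' hq'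
    have hθp : θ ^ p < 1 := ENNReal.rpow_lt_one hθ hp0
    set N : ℝ≥0∞ := 2 * (1 - θ ^ p)⁻¹ with hN
    have hNt : N ≠ ∞ := fin _ hθp
    have hC : M * N ^ (1 / p) ≠ ∞ :=
      ENNReal.mul_ne_top (fin θ hθ) (ENNReal.rpow_ne_top_of_nonneg (by positivity) hNt)
    refine ⟨(M * N ^ (1 / p)).toNNReal, fun β => ?_⟩
    rw [ENNReal.coe_toNNReal hC, eLpNorm_eq_lintegral_rpow_enorm_toReal hq.ne' hq',
      eLpNorm_eq_lintegral_rpow_enorm_toReal hq.ne' hq', lintegral_count, lintegral_count]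
    simp only [enorm_eq_self, ← hp]
    have key : ∑' k, (∑' j, (θ ^ 2) ^ Nat.dist k j * β j) ^ p ≤ M ^ p * (N * ∑' j, β j ^ p) := by
      calc ∑' k, (∑' j, (θ ^ 2) ^ Nat.dist k j * β j) ^ p
          ≤ ∑' k, M ^ p * ∑' j, (θ ^ p) ^ Nat.dist k j * β j ^ p := by
            refine ENNReal.tsum_le_tsum fun k => ?_
            refine (ENNReal.rpow_le_rpow (tsum_sq_pow_dist_mul_le hθ.le β k) hp0.le).trans ?_
            rw [ENNReal.mul_rpow_of_nonneg _ _ hp0.le]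
            gcongr
            rw [(ENNReal.monotone_rpow_of_nonneg hp0.le).map_iSup_of_continuousAt
              ENNReal.continuous_rpow_const.continuousAt (by simp [hp0])]
            refine iSup_le fun j => ?_
            refine le_trans (le_of_eq ?_) (ENNReal.le_tsum j)
            rw [ENNReal.mul_rpow_of_nonneg _ _ hp0.le, ← ENNReal.rpow_natCast,
              ← ENNReal.rpow_natCast, ← ENNReal.rpow_mul, ← ENNReal.rpow_mul, mul_comm p]
        _ = M ^ p * ∑' j, (∑' k, (θ ^ p) ^ Nat.dist k j) * β j ^ p := by
            rw [ENNReal.tsum_mul_left, ENNReal.tsum_comm]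
            simp only [ENNReal.tsum_mul_right]
        _ ≤ M ^ p * (N * ∑' j, β j ^ p) := by
            rw [← ENNReal.tsum_mul_left (a := N)]
            gcongr with j
            exact tsum_pow_dist_le hθp.le j
    clear_value M N
    calc (∑' k, (∑' j, (θ ^ 2) ^ Nat.dist k j * β j) ^ p) ^ (1 / p)
        ≤ (M ^ p * (N * ∑' j, β j ^ p)) ^ (1 / p) := by gcongr
      _ = M * N ^ (1 / p) * (∑' j, β j ^ p) ^ (1 / p) := by
        rw [ENNReal.mul_rpow_of_nonneg _ _ (by positivity),
          ENNReal.mul_rpow_of_nonneg _ _ (by positivity), ← ENNReal.rpow_mul,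
          mul_one_div_cancel hp0.ne', ENNReal.rpow_one, mul_assoc]

end BlockRadial

/-! ### Convolution with dilated Schwartz kernels -/

namespace BlockRadial

section Dilation

variable {E : Type*} [NormedAddCommGroup E] [NormedSpace ℝ E]

/-- The dilated Schwartz function `ξ ↦ φ(2^{-j} ξ)`. -/
noncomputable def dilate (φ : 𝓢(E, ℂ)) (j : ℕ) : 𝓢(E, ℂ) :=
  SchwartzMap.compCLMOfContinuousLinearEquiv ℂ (ContinuousLinearEquiv.smulLeft
    (Units.mk0 (((2 : ℝ) ^ j)⁻¹) (by positivity))) φ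

@[simp]
theorem dilate_apply (φ : 𝓢(E, ℂ)) (j : ℕ) (ξ : E) : dilate φ j ξ = φ (((2 : ℝ) ^ j)⁻¹ • ξ) :=
  rfl

/-- A bound on the increments of `F` over distances at most `t` controls all increments, with a
factor that grows linearly in the distance. -/
theorem norm_sub_le_of_modulus {F : E → ℂ} {t ω : ℝ} (ht : 0 < t)
    (h : ∀ x y, ‖x - y‖ ≤ t → ‖F x - F y‖ ≤ ω) (x z : E) :
    ‖F (x - z) - F x‖ ≤ (1 + t⁻¹ * ‖z‖) * ω := by
  have hω : 0 ≤ ω := (norm_nonneg _).trans (h x x (by simpa using ht.le))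
  -- walk from `x` to `x - z` in `⌈|z| / t⌉` equal steps of length at most `t`
  have step : ∀ (v : E), ‖v‖ ≤ t → ∀ n : ℕ, ‖F (x - (n : ℝ) • v) - F x‖ ≤ n * ω := by
    intro v hv n
    induction n with
    | zero => simp
    | succ n ih =>
      have h1 := h (x - ((n + 1 : ℕ) : ℝ) • v) (x - (n : ℝ) • v) (by
        rw [show x - ((n + 1 : ℕ) : ℝ) • v - (x - (n : ℝ) • v) = -v by push_cast; module]
        simpa using hv)
      have h2 := norm_add_le (F (x - ((n + 1 : ℕ) : ℝ) • v) - F (x - (n : ℝ) • v))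
        (F (x - (n : ℝ) • v) - F x)
      rw [sub_add_sub_cancel] at h2
      push_cast at *
      linarith
  set n := ⌈t⁻¹ * ‖z‖⌉₊ with hn
  have hn1 : t⁻¹ * ‖z‖ ≤ n := Nat.le_ceil _
  have hn2 : (n : ℝ) < t⁻¹ * ‖z‖ + 1 := Nat.ceil_lt_add_one (by positivity)
  rcases Nat.eq_zero_or_pos n with h0 | h0
  · have hz : z = 0 := by
      rw [h0] at hn1
      have : t⁻¹ * ‖z‖ = 0 := le_antisymm (by simpa using hn1) (by positivity)
      simpa [ht.ne'] using this
    simp [hz, hω]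
  · have hn0 : (0 : ℝ) < n := by exact_mod_cast h0
    have hv : ‖(n : ℝ)⁻¹ • z‖ ≤ t := by
      rw [norm_smul, Real.norm_of_nonneg (by positivity), inv_mul_le_iff₀ hn0]
      rwa [inv_mul_le_iff₀ ht, mul_comm] at hn1
    have := step _ hv n
    rw [smul_inv_smul₀ hn0.ne'] at this
    refine this.trans ?_
    gcongr
    linarith

end Dilation

section LowPass

open scoped FourierTransform

variable {E : Type*} [NormedAddCommGroup E] [InnerProductSpace ℝ E] [FiniteDimensional ℝ E]
  [MeasurableSpace E] [BorelSpace E]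

/-- The kernel `𝓕⁻¹(φ(2^{-j} ·))` of the Fourier multiplier with symbol `φ(2^{-j} ·)`. -/
noncomputable def kernel (φ : 𝓢(E, ℂ)) (j : ℕ) : 𝓢(E, ℂ) := 𝓕⁻ (dilate φ j)

theorem kernel_apply (φ : 𝓢(E, ℂ)) (j : ℕ) (x : E) :
    kernel φ j x = (((2 : ℝ) ^ j) ^ Module.finrank ℝ E) • (𝓕⁻ φ : 𝓢(E, ℂ)) ((2 : ℝ) ^ j • x) := by
  have h2 : ((2 : ℝ) ^ j) ≠ 0 := by positivity
  rw [kernel, SchwartzMap.fourierInv_coe, SchwartzMap.fourierInv_coe, Real.fourierInv_eq',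
    Real.fourierInv_eq']
  have h := Measure.integral_comp_smul_of_nonneg (volume : Measure E)
    (fun v => Complex.exp (↑(2 * Real.pi * inner ℝ v ((2 : ℝ) ^ j • x)) * Complex.I) • φ v)
    ((2 : ℝ) ^ j)⁻¹ (hR := by positivity)
  rw [inv_pow, inv_inv] at h
  rw [← h]
  refine integral_congr_ae (Filter.Eventually.of_forall fun v => ?_)
  simp only [dilate_apply, inner_smul_left, inner_smul_right]
  simp [h2]

theorem integral_dilated (j : ℕ) (g : E → ℝ) :
    ∫ x, ((2 : ℝ) ^ j) ^ Module.finrank ℝ E * g ((2 : ℝ) ^ j • x) = ∫ x, g x := by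
  rw [integral_const_mul, Measure.integral_comp_smul_of_nonneg volume g _ (hR := by positivity),
    smul_eq_mul,
    mul_inv_cancel_left₀ (by positivity)]

theorem integral_norm_kernel (φ : 𝓢(E, ℂ)) (j : ℕ) :
    ∫ x, ‖kernel φ j x‖ = ∫ x, ‖(𝓕⁻ φ : 𝓢(E, ℂ)) x‖ := by
  rw [← integral_dilated j fun x => ‖(𝓕⁻ φ : 𝓢(E, ℂ)) x‖]
  refine integral_congr_ae (Filter.Eventually.of_forall fun x => ?_)
  simp only [kernel_apply, norm_smul]
  rw [Real.norm_of_nonneg (by positivity)]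

theorem integral_norm_kernel_mul (φ : 𝓢(E, ℂ)) (j : ℕ) :
    ∫ x, ‖kernel φ j x‖ * (1 + 2 ^ j * ‖x‖) = ∫ x, ‖(𝓕⁻ φ : 𝓢(E, ℂ)) x‖ * (1 + ‖x‖) := by
  rw [← integral_dilated j fun x => ‖(𝓕⁻ φ : 𝓢(E, ℂ)) x‖ * (1 + ‖x‖)]
  refine integral_congr_ae (Filter.Eventually.of_forall fun x => ?_)
  simp only [kernel_apply, norm_smul]
  rw [Real.norm_of_nonneg (by positivity), Real.norm_of_nonneg (by positivity)]
  ring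

theorem integrable_norm_mul_one_add (K : 𝓢(E, ℂ)) (c : ℝ) :
    Integrable (fun x => ‖K x‖ * (1 + c * ‖x‖)) volume := by
  have h := K.integrable.norm.add ((K.integrable_pow_mul volume 1).const_mul c)
  refine h.congr (Filter.Eventually.of_forall fun x => ?_)
  simp only [Pi.add_apply, pow_one]
  ring

theorem integral_kernel (φ : 𝓢(E, ℂ)) (j : ℕ) : ∫ x, kernel φ j x = φ 0 := by
  have h : (𝓕 (kernel φ j)) 0 = φ 0 := by
    rw [kernel, FourierTransform.fourier_fourierInv_eq]
    simp
  rw [← h, SchwartzMap.fourier_coe, Real.fourier_eq']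
  simp

/-- Translation is Lipschitz continuous in `L_1` on Schwartz functions. -/
theorem lintegral_translate_sub_le (K : 𝓢(E, ℂ)) (h : E) :
    ∫⁻ z, ‖K (z + h) - K z‖ₑ ≤ (∫⁻ z, ‖fderiv ℝ K z‖ₑ) * ‖h‖ₑ := by
  have cD : Continuous (fderiv ℝ K) := (SchwartzMap.fderivCLM ℝ E ℂ K).continuous
  have pt : ∀ z, ‖K (z + h) - K z‖ₑ ≤
      ∫⁻ t in Set.Ioc (0 : ℝ) 1, ‖fderiv ℝ K (z + t • h)‖ₑ * ‖h‖ₑ := by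
    intro z
    have hd : ∀ t ∈ Set.uIcc (0 : ℝ) 1, HasDerivAt (fun t : ℝ => K (z + t • h))
        (fderiv ℝ K (z + t • h) h) t := by
      intro t _
      have h1 : HasDerivAt (fun t : ℝ => z + t • h) h t := by
        simpa using ((hasDerivAt_id t).smul_const h).const_add z
      exact (K.hasFDerivAt (z + t • h)).comp_hasDerivAt t h1
    have hc : Continuous fun t : ℝ => fderiv ℝ K (z + t • h) h := by fun_prop
    have e := intervalIntegral.integral_eq_sub_of_hasDerivAt hd (hc.intervalIntegrable 0 1)
    simp only [one_smul, zero_smul, add_zero] at e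
    rw [← e, intervalIntegral.integral_of_le zero_le_one]
    refine (enorm_integral_le_lintegral_enorm _).trans (lintegral_mono fun t => ?_)
    exact ContinuousLinearMap.le_opENorm _ _
  calc ∫⁻ z, ‖K (z + h) - K z‖ₑ
      ≤ ∫⁻ z, ∫⁻ t in Set.Ioc (0 : ℝ) 1, ‖fderiv ℝ K (z + t • h)‖ₑ * ‖h‖ₑ := lintegral_mono pt
    _ = ∫⁻ t in Set.Ioc (0 : ℝ) 1, ∫⁻ z, ‖fderiv ℝ K (z + t • h)‖ₑ * ‖h‖ₑ := by
        refine lintegral_lintegral_swap (Continuous.aemeasurable ?_)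
        have : Continuous fun p : E × ℝ => ‖fderiv ℝ K (p.1 + p.2 • h)‖ₑ := by fun_prop
        exact ENNReal.continuous_mul_const (by simp) |>.comp this
    _ = ∫⁻ t in Set.Ioc (0 : ℝ) 1, (∫⁻ z, ‖fderiv ℝ K z‖ₑ) * ‖h‖ₑ := by
        refine lintegral_congr fun t => ?_
        rw [lintegral_mul_const' _ _ (by simp),
          lintegral_add_right_eq_self (fun z => ‖fderiv ℝ K z‖ₑ)]
    _ = _ := by simp

theorem integral_translate_sub_le (K : 𝓢(E, ℂ)) (h : E) :
    ∫ z, ‖K (z + h) - K z‖ ≤ (∫ z, ‖fderiv ℝ K z‖) * ‖h‖ := by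
  have iD : Integrable (fderiv ℝ K) volume := (SchwartzMap.fderivCLM ℝ E ℂ K).integrable
  have iK : Integrable (fun z => K (z + h) - K z) volume :=
    (K.integrable.comp_add_right h).sub K.integrable
  rw [integral_norm_eq_lintegral_enorm iK.1, integral_norm_eq_lintegral_enorm iD.1,
    ← toReal_enorm h, ← ENNReal.toReal_mul]
  exact ENNReal.toReal_mono (ENNReal.mul_ne_top iD.2.ne (by simp)) (lintegral_translate_sub_le K h)

theorem integral_kernel_translate_sub_le (φ : 𝓢(E, ℂ)) (j : ℕ) (h : E) :
    ∫ z, ‖kernel φ j (z + h) - kernel φ j z‖ ≤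
      (∫ z, ‖fderiv ℝ (𝓕⁻ φ : 𝓢(E, ℂ)) z‖) * (2 ^ j * ‖h‖) := by
  have e : ∫ z, ‖kernel φ j (z + h) - kernel φ j z‖ =
      ∫ z, ‖(𝓕⁻ φ : 𝓢(E, ℂ)) (z + (2 : ℝ) ^ j • h) - (𝓕⁻ φ : 𝓢(E, ℂ)) z‖ := by
    rw [← integral_dilated j fun z =>
      ‖(𝓕⁻ φ : 𝓢(E, ℂ)) (z + (2 : ℝ) ^ j • h) - (𝓕⁻ φ : 𝓢(E, ℂ)) z‖]
    refine integral_congr_ae (Filter.Eventually.of_forall fun x => ?_)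
    simp only [kernel_apply, ← smul_sub, smul_add, norm_smul]
    rw [Real.norm_of_nonneg (by positivity)]
  rw [e]
  refine (integral_translate_sub_le _ _).trans (le_of_eq ?_)
  rw [norm_smul, Real.norm_of_nonneg (by positivity)]

/-- The convolution of `F` with `𝓕⁻¹(φ(2^{-j} ·))`: for a dyadic generator `φ` this keeps the
frequencies up to about `2^j`. -/
noncomputable def lowPass (φ : 𝓢(E, ℂ)) (j : ℕ) (F : E → ℂ) (x : E) : ℂ :=
  ∫ z, kernel φ j (x - z) * F z

theorem lowPass_eq (φ : 𝓢(E, ℂ)) (j : ℕ) (F : E → ℂ) (x : E) :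
    lowPass φ j F x = ∫ z, kernel φ j z * F (x - z) := by
  rw [lowPass, ← integral_sub_left_eq_self _ volume x]
  simp

section Bounded

variable {F : E → ℂ} {M : ℝ}

theorem integrable_kernel_mul (φ : 𝓢(E, ℂ)) (j : ℕ) (hF : AEStronglyMeasurable F volume)
    (hM : ∀ᵐ x, ‖F x‖ ≤ M) (x : E) : Integrable (fun z => kernel φ j (x - z) * F z) volume :=
  ((kernel φ j).integrable.comp_sub_left x).mul_bdd hF hM

theorem norm_lowPass_le (φ : 𝓢(E, ℂ)) (j : ℕ) (hM : ∀ᵐ x, ‖F x‖ ≤ M) (x : E) :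
    ‖lowPass φ j F x‖ ≤ (∫ x, ‖(𝓕⁻ φ : 𝓢(E, ℂ)) x‖) * M := by
  rw [← integral_norm_kernel φ j, ← integral_mul_const,
    ← integral_sub_left_eq_self (fun z => ‖kernel φ j z‖ * M) volume x]
  refine norm_integral_le_of_norm_le
    (((kernel φ j).integrable.norm.mul_const M).comp_sub_left x) ?_
  filter_upwards [hM] with z hz
  rw [norm_mul]
  gcongr

theorem norm_lowPass_sub_le (φ : 𝓢(E, ℂ)) (j : ℕ) (hF : AEStronglyMeasurable F volume)
    (hM : ∀ᵐ x, ‖F x‖ ≤ M) (x y : E) :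
    ‖lowPass φ j F x - lowPass φ j F y‖ ≤
      (∫ z, ‖fderiv ℝ (𝓕⁻ φ : 𝓢(E, ℂ)) z‖) * (2 ^ j * ‖x - y‖) * M := by
  have hM0 : 0 ≤ M := by
    obtain ⟨z, hz⟩ := hM.exists
    exact (norm_nonneg _).trans hz
  have iK := ((kernel φ j).integrable.comp_add_right (μ := volume) (x - y)).sub
    (kernel φ j).integrable
  rw [lowPass, lowPass, ← integral_sub (integrable_kernel_mul φ j hF hM x)
    (integrable_kernel_mul φ j hF hM y)]
  refine le_trans ?_ (mul_le_mul_of_nonneg_right (integral_kernel_translate_sub_le φ j (x - y)) hM0)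
  rw [← integral_mul_const, ← integral_sub_left_eq_self
    (fun z => ‖kernel φ j (z + (x - y)) - kernel φ j z‖ * M) volume y]
  refine norm_integral_le_of_norm_le ((iK.norm.mul_const M).comp_sub_left y) ?_
  filter_upwards [hM] with z hz
  rw [← sub_mul, norm_mul, show y - z + (x - y) = x - z by abel]
  gcongr

theorem continuous_lowPass (φ : 𝓢(E, ℂ)) (j : ℕ) (hF : AEStronglyMeasurable F volume)
    (hM : ∀ᵐ x, ‖F x‖ ≤ M) : Continuous (lowPass φ j F) := by
  have hM0 : 0 ≤ M := by
    obtain ⟨z, hz⟩ := hM.exists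
    exact (norm_nonneg _).trans hz
  have hC : 0 ≤ (∫ z, ‖fderiv ℝ (𝓕⁻ φ : 𝓢(E, ℂ)) z‖) * 2 ^ j * M := by positivity
  refine (LipschitzWith.of_dist_le_mul (K := ⟨_, hC⟩) fun x y => ?_).continuous
  rw [dist_eq_norm, dist_eq_norm]
  refine (norm_lowPass_sub_le φ j hF hM x y).trans (le_of_eq ?_)
  change _ = (∫ z, ‖fderiv ℝ (𝓕⁻ φ : 𝓢(E, ℂ)) z‖) * 2 ^ j * M * ‖x - y‖
  ring

/-- On test functions, a Fourier multiplier with Schwartz symbol acts by correlation with its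
kernel. -/
theorem fourier_smulLeftCLM_fourierInv_apply (χ u : 𝓢(E, ℂ)) (x : E) :
    𝓕 (SchwartzMap.smulLeftCLM ℂ χ (𝓕⁻ u)) x = ∫ y, (𝓕⁻ χ) (y - x) * u y := by
  let B : ℂ →L[ℂ] ℂ →L[ℂ] ℂ := ContinuousLinearMap.mul ℂ ℂ
  let v : 𝓢(E, ℂ) := SchwartzMap.compCLMOfContinuousLinearEquiv ℂ
    (LinearIsometryEquiv.neg ℝ (E := E)).toContinuousLinearEquiv u
  have hv : 𝓕 v = 𝓕⁻ u := by
    ext ξ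
    rw [SchwartzMap.fourier_coe, SchwartzMap.fourierInv_coe, Real.fourierInv_eq_fourier_comp_neg]
    rfl
  have hw : 𝓕⁻ (SchwartzMap.smulLeftCLM ℂ χ (𝓕⁻ u)) = SchwartzMap.convolution B v (𝓕⁻ χ) := by
    rw [← FourierTransform.fourierInv_fourier_eq (E := 𝓢(E, ℂ)) (F := 𝓢(E, ℂ))
      (SchwartzMap.convolution B v (𝓕⁻ χ)), SchwartzMap.fourier_convolution, hv,
      FourierTransform.fourier_fourierInv_eq]
    congr 1
    ext ξ
    rw [SchwartzMap.smulLeftCLM_apply_apply χ.hasTemperateGrowth,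
      SchwartzMap.pairing_apply_apply]
    simp [B, mul_comm]
  have h1 : ∀ W : 𝓢(E, ℂ), 𝓕 W x = 𝓕⁻ W (-x) := fun W => by
    rw [SchwartzMap.fourierInv_apply_eq]
    simp
  rw [h1, hw, SchwartzMap.convolution_apply, convolution_def, ← integral_neg_eq_self]
  refine integral_congr_ae (Filter.Eventually.of_forall fun y => ?_)
  simp only [B, v, ContinuousLinearMap.mul_apply', sub_neg_eq_add]
  rw [SchwartzMap.compCLMOfContinuousLinearEquiv_apply, neg_add_eq_sub, mul_comm]
  simp

/-- The Fourier multiplier with symbol `φ(2^{-j} ·)` maps a bounded function to its convolution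
with the kernel. -/
theorem Represents.lowPass {T : 𝓢'(E, ℂ)} (hT : Represents F T) (hM : ∀ᵐ x, ‖F x‖ ≤ M)
    (φ : 𝓢(E, ℂ)) (j : ℕ) :
    Represents (lowPass φ j F)
      (TemperedDistribution.fourierMultiplierCLM ℂ (dilate φ j) T) := by
  have hm := (continuous_lowPass φ j hT.1 hM).aestronglyMeasurable (μ := (volume : Measure E))
  refine ⟨hm, fun u => ⟨integrable_schwartz_mul u hm
    (Filter.Eventually.of_forall (norm_lowPass_le φ j hM)), ?_⟩⟩
  rw [TemperedDistribution.fourierMultiplierCLM_apply_apply, (hT.2 _).2]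
  simp only [fourier_smulLeftCLM_fourierInv_apply]
  have hK : Integrable (fun z => kernel φ j (-z)) volume := (kernel φ j).integrable.comp_neg
  have hint : Integrable (fun p : E × E => (kernel φ j (p.2 - p.1) * u p.2) * F p.1)
      (volume.prod volume) := by
    refine Integrable.mul_bdd (c := M) ?_ hT.1.comp_fst ?_
    · have := Integrable.convolution_integrand (ContinuousLinearMap.mul ℂ ℂ)
        (u.integrable (μ := volume)) hK
      refine this.congr (Filter.Eventually.of_forall fun p => ?_)
      simp [mul_comm]
    · exact Measure.quasiMeasurePreserving_fst.ae hM
  calc ∫ x, (∫ y, kernel φ j (y - x) * u y) * F x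
      = ∫ x, ∫ y, (kernel φ j (y - x) * u y) * F x := by
        simp only [integral_mul_const]
    _ = ∫ y, ∫ x, (kernel φ j (y - x) * u y) * F x := integral_integral_swap hint
    _ = ∫ y, u y * BlockRadial.lowPass φ j F y := by
        refine integral_congr_ae (Filter.Eventually.of_forall fun y => ?_)
        simp only [BlockRadial.lowPass, ← integral_const_mul]
        refine integral_congr_ae (Filter.Eventually.of_forall fun x => ?_)
        ring

end Bounded

/-- Approximation by low frequencies: a kernel of integral one reproduces `F` up to its modulus of
continuity at the scale of the kernel. -/
theorem norm_lowPass_sub_self_le {φ : 𝓢(E, ℂ)} (hφ : φ 0 = 1) {F : E → ℂ}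
    (cF : Continuous F) {M : ℝ} (hM : ∀ x, ‖F x‖ ≤ M) {i j : ℕ} (hij : i ≤ j + 1) {ω : ℝ}
    (h : ∀ x y, ‖x - y‖ ≤ ((2 : ℝ) ^ i)⁻¹ → ‖F x - F y‖ ≤ ω) (x : E) :
    ‖lowPass φ j F x - F x‖ ≤ 2 * (∫ z, ‖(𝓕⁻ φ : 𝓢(E, ℂ)) z‖ * (1 + ‖z‖)) * ω := by
  have hω : 0 ≤ ω := (norm_nonneg _).trans (h x x (by simp))
  have i1 : Integrable (fun z => kernel φ j z * F (x - z)) volume :=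
    (kernel φ j).integrable.mul_bdd (by fun_prop) (Filter.Eventually.of_forall fun z => hM (x - z))
  have e : lowPass φ j F x - F x = ∫ z, kernel φ j z * (F (x - z) - F x) := by
    simp only [mul_sub]
    rw [integral_sub i1 ((kernel φ j).integrable.mul_const _), integral_mul_const,
      integral_kernel, hφ, one_mul, lowPass_eq]
  rw [e, ← integral_norm_kernel_mul φ j, ← integral_const_mul, ← integral_mul_const]
  refine norm_integral_le_of_norm_le (((integrable_norm_mul_one_add _ _).const_mul 2).mul_const ω)
    (Filter.Eventually.of_forall fun z => ?_)
  have h1 := norm_sub_le_of_modulus (by positivity) h x z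
  rw [inv_inv] at h1
  have h2 : (2 : ℝ) ^ i ≤ 2 * 2 ^ j := by
    rw [← pow_succ']
    exact pow_le_pow_right₀ (by norm_num) hij
  rw [norm_mul]
  calc ‖kernel φ j z‖ * ‖F (x - z) - F x‖
      ≤ ‖kernel φ j z‖ * ((1 + 2 ^ i * ‖z‖) * ω) := by gcongr
    _ ≤ ‖kernel φ j z‖ * ((2 * (1 + 2 ^ j * ‖z‖)) * ω) := by
        have := mul_le_mul_of_nonneg_right h2 (norm_nonneg z)
        gcongr ‖kernel φ j z‖ * (?_ * ω)
        linarith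
    _ = 2 * (‖kernel φ j z‖ * (1 + 2 ^ j * ‖z‖)) * ω := by ring

end LowPass

end BlockRadial

/-! ### Moduli of continuity bound the Besov norm -/

namespace BlockRadial

theorem eLpNorm_count_le_mul {a b : ℕ → ℝ≥0∞} {C : ℝ≥0} (h : ∀ j, a j ≤ C * b j) (q : ℝ≥0∞) :
    eLpNorm a q Measure.count ≤ C * eLpNorm b q Measure.count :=
  eLpNorm_le_nnreal_smul_eLpNorm_of_ae_le_mul' (Filter.Eventually.of_forall fun j => by
    simpa only [enorm_eq_self] using h j) q

/-- The moduli of continuity of `F` at the scales `2^{-j}`, `j ≥ 1`, preceded by the supremum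
norm of `F` in the place `j = 0`. -/
noncomputable def dyadicModulus {E : Type*} [NormedAddCommGroup E] (F : E → ℂ) : ℕ → ℝ≥0∞
  | 0 => ⨆ x, ‖F x‖ₑ
  | j + 1 => ⨆ (x : E) (y : E) (_ : ‖x - y‖ ≤ ((2 : ℝ) ^ (j + 1))⁻¹), ‖F x - F y‖ₑ

/-- The norm of `B^s_{∞,q}`, `0 < s < 1`, in terms of first order differences. -/
noncomputable def modulusNorm {E : Type*} [NormedAddCommGroup E] (s : ℝ) (q : ℝ≥0∞)
    (F : E → ℂ) : ℝ≥0∞ :=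
  eLpNorm (fun j : ℕ => (2 : ℝ≥0∞) ^ ((j : ℝ) * s) * dyadicModulus F j) q Measure.count

theorem modulusNorm_comp_le {E E' : Type*} [NormedAddCommGroup E] [NormedAddCommGroup E']
    (s : ℝ) (q : ℝ≥0∞) (F : E → ℂ) {p : E' → E} (hp : ∀ x y, ‖p x - p y‖ ≤ ‖x - y‖) :
    modulusNorm s q (fun x => F (p x)) ≤ modulusNorm s q F := by
  refine eLpNorm_mono_enorm fun j => ?_
  simp only [enorm_eq_self]
  gcongr
  cases j with
  | zero => exact iSup_le fun x => le_iSup (fun y => ‖F y‖ₑ) (p x)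
  | succ j =>
    refine iSup_le fun x => iSup_le fun y => iSup_le fun h => ?_
    exact le_iSup₂_of_le (p x) (p y) (le_iSup_of_le ((hp x y).trans h) le_rfl)

theorem enorm_sub_le_dyadicModulus {E : Type*} [NormedAddCommGroup E] (F : E → ℂ) (j : ℕ) {x y : E}
    (h : ‖x - y‖ ≤ ((2 : ℝ) ^ (j + 1))⁻¹) : ‖F x - F y‖ₑ ≤ dyadicModulus F (j + 1) :=
  le_iSup₂_of_le x y (le_iSup_of_le h le_rfl)

theorem dyadicModulus_ne_top {E : Type*} [NormedAddCommGroup E] {F : E → ℂ} {M : ℝ}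
    (hM : ∀ x, ‖F x‖ ≤ M) (j : ℕ) : dyadicModulus F j ≠ ∞ := by
  have h : ∀ x, ‖F x‖ₑ ≤ ENNReal.ofReal M := fun x => by
    rw [← ofReal_norm]
    exact ENNReal.ofReal_le_ofReal (hM x)
  refine ne_top_of_le_ne_top (b := ENNReal.ofReal M + ENNReal.ofReal M) (by simp) ?_
  cases j with
  | zero => exact iSup_le fun x => (h x).trans le_self_add
  | succ j =>
    refine iSup_le fun x => iSup_le fun y => iSup_le fun _ => ?_
    exact (enorm_sub_le).trans (add_le_add (h x) (h y))

section Pieces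

open scoped FourierTransform

variable {E : Type*} [NormedAddCommGroup E] [InnerProductSpace ℝ E] [FiniteDimensional ℝ E]
  [MeasurableSpace E] [BorelSpace E]

theorem fourierMultiplierCLM_dyadicPiece_zero (φ : 𝓢(E, ℂ)) (T : 𝓢'(E, ℂ)) :
    TemperedDistribution.fourierMultiplierCLM ℂ (dyadicPiece φ 0) T =
      TemperedDistribution.fourierMultiplierCLM ℂ (dilate φ 0) T := by
  have : dyadicPiece φ 0 = dilate φ 0 := by
    funext ξ
    simp [dyadicPiece]
  rw [this]

theorem fourierMultiplierCLM_dyadicPiece_succ (φ : 𝓢(E, ℂ)) (j : ℕ) (T : 𝓢'(E, ℂ)) :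
    TemperedDistribution.fourierMultiplierCLM ℂ (dyadicPiece φ (j + 1)) T =
      TemperedDistribution.fourierMultiplierCLM ℂ (dilate φ (j + 1)) T -
        TemperedDistribution.fourierMultiplierCLM ℂ (dilate φ j) T := by
  have : dyadicPiece φ (j + 1) = (dilate φ (j + 1) : E → ℂ) - (dilate φ j : E → ℂ) := rfl
  simp only [TemperedDistribution.fourierMultiplierCLM_apply, this]
  rw [TemperedDistribution.smulLeftCLM_sub (dilate φ (j + 1)).hasTemperateGrowth
    (dilate φ j).hasTemperateGrowth]
  exact map_sub (FourierTransform.fourierInvCLM ℂ 𝓢'(E, ℂ)) _ _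

/-- The dyadic pieces of a bounded continuous function are controlled by its moduli of
continuity, because the kernels of the pieces have integral zero. -/
theorem exists_distLpNorm_dyadicPiece_le {φ : 𝓢(E, ℂ)} (hφ : IsDyadicGenerator φ)
    (w : E → ℝ≥0∞) :
    ∃ C : ℝ≥0, ∀ (F : E → ℂ) (T : 𝓢'(E, ℂ)), Continuous F → (∃ M, ∀ x, ‖F x‖ ≤ M) →
      Represents F T → ∀ j,
        distLpNorm w ∞ (TemperedDistribution.fourierMultiplierCLM ℂ (dyadicPiece φ j) T) ≤
          C * dyadicModulus F j := by
  set A : ℝ := ∫ z, ‖(𝓕⁻ φ : 𝓢(E, ℂ)) z‖ with hA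
  set B : ℝ := ∫ z, ‖(𝓕⁻ φ : 𝓢(E, ℂ)) z‖ * (1 + ‖z‖) with hB
  have hA0 : 0 ≤ A := integral_nonneg fun z => norm_nonneg _
  have hB0 : 0 ≤ B := integral_nonneg fun z => by positivity
  have h0 : φ 0 = 1 := hφ.1 0 (by simp)
  refine ⟨(A + 4 * B).toNNReal, ?_⟩
  rintro F T cF ⟨M, hM⟩ hT j
  have hM' : ∀ᵐ x, ‖F x‖ ≤ M := Filter.Eventually.of_forall hM
  have hfin := dyadicModulus_ne_top hM j
  have hC : ((A + 4 * B).toNNReal : ℝ≥0∞) * dyadicModulus F j =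
      ENNReal.ofReal ((A + 4 * B) * (dyadicModulus F j).toReal) := by
    rw [ENNReal.ofReal_mul (by positivity), ENNReal.ofReal_toReal hfin]
    rfl
  rw [hC]
  cases j with
  | zero =>
    rw [fourierMultiplierCLM_dyadicPiece_zero]
    refine distLpNorm_top_le (hT.lowPass hM' φ 0) w fun x => ?_
    rw [← ofReal_norm]
    refine ENNReal.ofReal_le_ofReal ?_
    have hb : ∀ x, ‖F x‖ ≤ (dyadicModulus F 0).toReal := fun x => by
      rw [← toReal_enorm]
      exact ENNReal.toReal_mono hfin (le_iSup (fun y => ‖F y‖ₑ) x)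
    refine (norm_lowPass_le φ 0 (Filter.Eventually.of_forall hb) x).trans ?_
    rw [← hA]
    gcongr
    linarith
  | succ j =>
    rw [fourierMultiplierCLM_dyadicPiece_succ]
    refine distLpNorm_top_le ((hT.lowPass hM' φ (j + 1)).sub (hT.lowPass hM' φ j)) w fun x => ?_
    rw [← ofReal_norm]
    refine ENNReal.ofReal_le_ofReal ?_
    have hb : ∀ x y : E, ‖x - y‖ ≤ ((2 : ℝ) ^ (j + 1))⁻¹ →
        ‖F x - F y‖ ≤ (dyadicModulus F (j + 1)).toReal := fun x y h => by
      rw [← toReal_enorm]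
      exact ENNReal.toReal_mono hfin (enorm_sub_le_dyadicModulus F j h)
    have e1 := norm_lowPass_sub_self_le h0 cF hM (j := j + 1) (by omega) hb x
    have e2 := norm_lowPass_sub_self_le h0 cF hM (j := j) (by omega) hb x
    have e3 := norm_sub_le_norm_sub_add_norm_sub (lowPass φ (j + 1) F x) (F x) (lowPass φ j F x)
    rw [norm_sub_rev (F x)] at e3
    rw [← hB] at e1 e2
    have e4 : 0 ≤ A * (dyadicModulus F (j + 1)).toReal := by positivity
    rw [Pi.sub_apply]
    linarith

theorem exists_besovNorm_le_modulusNorm {φ : 𝓢(E, ℂ)} (hφ : IsDyadicGenerator φ)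
    (w : E → ℝ≥0∞) (s : ℝ) (q : ℝ≥0∞) :
    ∃ C : ℝ≥0, ∀ (F : E → ℂ) (T : 𝓢'(E, ℂ)), Continuous F → (∃ M, ∀ x, ‖F x‖ ≤ M) →
      Represents F T → besovNorm φ w s ∞ q T ≤ C * modulusNorm s q F := by
  obtain ⟨C, hC⟩ := exists_distLpNorm_dyadicPiece_le hφ w
  refine ⟨C, fun F T cF hM hT => eLpNorm_count_le_mul (fun j => ?_) q⟩
  rw [mul_left_comm]
  gcongr
  exact hC F T cF hM hT j

end Pieces

end BlockRadial

/-! ### Littlewood–Paley decomposition of a tempered distribution -/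

namespace BlockRadial

section Decomposition

open scoped FourierTransform
open Filter Topology

variable {E : Type*} [NormedAddCommGroup E] [InnerProductSpace ℝ E]

theorem norm_iteratedFDeriv_dilate_le (φ : 𝓢(E, ℂ)) (i j : ℕ) (x : E) :
    ‖iteratedFDeriv ℝ i (dilate φ j) x‖ ≤ SchwartzMap.seminorm ℝ 0 i φ := by
  have e : (dilate φ j : E → ℂ) = fun z => φ (((2 : ℝ) ^ j)⁻¹ • z) := rfl
  rw [e, iteratedFDeriv_comp_const_smul _ (φ.smooth i), norm_smul]
  refine (mul_le_of_le_one_left (norm_nonneg _) ?_).trans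
    (SchwartzMap.norm_iteratedFDeriv_le_seminorm ℝ φ i _)
  rw [Real.norm_of_nonneg (by positivity)]
  exact pow_le_one₀ (by positivity) (inv_le_one_of_one_le₀ (one_le_pow₀ (by norm_num)))

/-- Smooth cut-offs at radius `2^j` converge to the identity on the Schwartz space. -/
theorem tendsto_smulLeftCLM_dilate {φ : 𝓢(E, ℂ)} (hφ : IsDyadicGenerator φ) (u : 𝓢(E, ℂ)) :
    Tendsto (fun j => SchwartzMap.smulLeftCLM ℂ (dilate φ j) u) atTop (𝓝 u) := by
  rw [(schwartz_withSeminorms ℝ E ℂ).tendsto_nhds]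
  rintro ⟨k, n⟩ ε hε
  set D : ℝ := (∑ i ∈ Finset.range (n + 1), (n.choose i : ℝ) * SchwartzMap.seminorm ℝ 0 i φ *
    SchwartzMap.seminorm ℝ (k + 1) (n - i) u) + SchwartzMap.seminorm ℝ (k + 1) n u with hD
  have hD0 : 0 ≤ D := by
    refine add_nonneg (Finset.sum_nonneg fun i _ => ?_) (apply_nonneg _ _)
    exact mul_nonneg (mul_nonneg (by positivity) (apply_nonneg _ _)) (apply_nonneg _ _)
  have hlim : Tendsto (fun j : ℕ => ((2 : ℝ) ^ j)⁻¹ * D) atTop (𝓝 (0 * D)) := by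
    refine Tendsto.mul_const D ?_
    simpa using tendsto_pow_atTop_nhds_zero_of_lt_one (r := (2 : ℝ)⁻¹) (by norm_num) (by norm_num)
  rw [zero_mul] at hlim
  filter_upwards [hlim.eventually_lt_const hε] with j hj
  refine lt_of_le_of_lt (SchwartzMap.seminorm_le_bound ℝ k n _ (by positivity) fun x => ?_) hj
  have hcoe : ∀ y, (SchwartzMap.smulLeftCLM ℂ (dilate φ j) u - u) y = dilate φ j y * u y - u y :=
    fun y => by
      rw [sub_apply,
        SchwartzMap.smulLeftCLM_apply_apply (dilate φ j).hasTemperateGrowth, smul_eq_mul]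
  have h2 : (0 : ℝ) < 2 ^ j := by positivity
  rcases lt_or_ge ‖x‖ ((2 : ℝ) ^ j) with hx | hx
  · -- the difference vanishes on the ball of radius `2^j`
    have hz : (SchwartzMap.smulLeftCLM ℂ (dilate φ j) u - u : E → ℂ) =ᶠ[𝓝 x] fun _ => 0 := by
      filter_upwards [(isOpen_lt continuous_norm continuous_const).mem_nhds hx] with y hy
      have : φ (((2 : ℝ) ^ j)⁻¹ • y) = 1 := hφ.1 _ (by
        rw [norm_smul, norm_inv, Real.norm_of_nonneg h2.le]
        exact inv_mul_le_one_of_le₀ (le_of_lt hy) h2.le)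
      have e := hcoe y
      rw [dilate_apply, this, one_mul, sub_self] at e
      exact e
    have hz' := (EventuallyEq.iteratedFDeriv ℝ hz n).eq_of_nhds
    have e0 : iteratedFDeriv ℝ n (fun _ : E => (0 : ℂ)) x = 0 := by
      simp
    change ‖x‖ ^ k * ‖iteratedFDeriv ℝ n (SchwartzMap.smulLeftCLM ℂ (dilate φ j) u - u : E → ℂ) x‖
      ≤ _
    rw [hz', e0, norm_zero, mul_zero]
    positivity
  · have hfun : ((SchwartzMap.smulLeftCLM ℂ (dilate φ j) u - u : 𝓢(E, ℂ)) : E → ℂ) =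
        (fun y => dilate φ j y * u y) - (u : E → ℂ) := funext hcoe
    have c1 : ContDiff ℝ n (fun y => dilate φ j y * u y) :=
      ((dilate φ j).smooth n).mul (u.smooth n)
    rw [hfun, iteratedFDeriv_sub_apply c1.contDiffAt (u.smooth n).contDiffAt]
    have h1 := norm_iteratedFDeriv_mul_le ((dilate φ j).smooth n) (u.smooth n) x le_rfl
    have hk : ‖x‖ ^ k ≤ ((2 : ℝ) ^ j)⁻¹ * ‖x‖ ^ (k + 1) := by
      rw [le_inv_mul_iff₀ h2, pow_succ, mul_comm]
      gcongr
    have hu : ∀ l, ‖x‖ ^ (k + 1) * ‖iteratedFDeriv ℝ l u x‖ ≤ SchwartzMap.seminorm ℝ (k + 1) l u :=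
      fun l => SchwartzMap.le_seminorm ℝ (k + 1) l u x
    calc ‖x‖ ^ k * ‖iteratedFDeriv ℝ n (fun y => dilate φ j y * u y) x - iteratedFDeriv ℝ n u x‖
        ≤ (((2 : ℝ) ^ j)⁻¹ * ‖x‖ ^ (k + 1)) *
          ((∑ i ∈ Finset.range (n + 1), (n.choose i : ℝ) * SchwartzMap.seminorm ℝ 0 i φ *
            ‖iteratedFDeriv ℝ (n - i) u x‖) + ‖iteratedFDeriv ℝ n u x‖) := by
          refine mul_le_mul hk ?_ (norm_nonneg _) (by positivity)
          refine (norm_sub_le _ _).trans (add_le_add_left (h1.trans ?_) _)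
          refine Finset.sum_le_sum fun i _ => ?_
          gcongr
          exact norm_iteratedFDeriv_dilate_le φ i j x
      _ = ((2 : ℝ) ^ j)⁻¹ * ((∑ i ∈ Finset.range (n + 1),
            (n.choose i : ℝ) * SchwartzMap.seminorm ℝ 0 i φ *
            (‖x‖ ^ (k + 1) * ‖iteratedFDeriv ℝ (n - i) u x‖)) +
              ‖x‖ ^ (k + 1) * ‖iteratedFDeriv ℝ n u x‖) := by
          rw [mul_assoc, mul_add, Finset.mul_sum]
          congr 2
          refine Finset.sum_congr rfl fun i _ => ?_
          ring
      _ ≤ ((2 : ℝ) ^ j)⁻¹ * D := by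
          rw [hD]
          gcongr with i hi
          · exact hu _
          · exact hu _

theorem hasTemperateGrowth_dyadicPiece (φ : 𝓢(E, ℂ)) (j : ℕ) :
    (dyadicPiece φ j).HasTemperateGrowth := by
  cases j with
  | zero => exact φ.hasTemperateGrowth
  | succ j => exact (dilate φ (j + 1)).hasTemperateGrowth.sub (dilate φ j).hasTemperateGrowth

/-- The cut-off `φ(2^{-(j+1)} ·)` equals one on the support of the `j`-th dyadic piece. -/
theorem dyadicPiece_mul_dilate {φ : 𝓢(E, ℂ)} (hφ : IsDyadicGenerator φ) (j : ℕ) :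
    dyadicPiece φ j * dilate φ (j + 1) = dyadicPiece φ j := by
  funext ξ
  rw [Pi.mul_apply, dilate_apply]
  have hn : ∀ i : ℕ, ‖((2 : ℝ) ^ i)⁻¹ • ξ‖ = ((2 : ℝ) ^ i)⁻¹ * ‖ξ‖ := fun i => by
    rw [norm_smul, Real.norm_of_nonneg (by positivity)]
  rcases le_or_gt ‖ξ‖ ((2 : ℝ) ^ (j + 1)) with h | h
  · rw [hφ.1 _ (by rw [hn]; exact inv_mul_le_one_of_le₀ h (by positivity)), mul_one]
  · have h0 : ∀ i ≤ j, φ (((2 : ℝ) ^ i)⁻¹ • ξ) = 0 := fun i hi => by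
      refine hφ.2 _ ?_
      rw [hn, le_inv_mul_iff₀ (by positivity)]
      have : (2 : ℝ) ^ i ≤ 2 ^ j := pow_le_pow_right₀ (by norm_num) hi
      rw [pow_succ] at h
      have : (0 : ℝ) < 2 ^ j := by positivity
      linarith
    have hz : dyadicPiece φ j ξ = 0 := by
      cases j with
      | zero => simpa [dyadicPiece] using h0 0 le_rfl
      | succ j => simp [dyadicPiece, h0 (j + 1) le_rfl, h0 j (by omega)]
    rw [hz, zero_mul]

variable [FiniteDimensional ℝ E] [MeasurableSpace E] [BorelSpace E]

theorem tendsto_fourierMultiplierCLM_dilate {φ : 𝓢(E, ℂ)} (hφ : IsDyadicGenerator φ)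
    (T : 𝓢'(E, ℂ)) (u : 𝓢(E, ℂ)) :
    Tendsto (fun j => TemperedDistribution.fourierMultiplierCLM ℂ (dilate φ j) T u) atTop
      (𝓝 (T u)) := by
  have h := tendsto_smulLeftCLM_dilate hφ (𝓕⁻ u)
  have c : Continuous fun v : 𝓢(E, ℂ) => T (𝓕 v) :=
    T.cont.comp (FourierTransform.fourierCLM ℂ 𝓢(E, ℂ)).continuous
  have := (c.tendsto _).comp h
  rw [FourierTransform.fourier_fourierInv_eq] at this
  exact this

theorem fourierMultiplierCLM_dilate_eq_sum (φ : 𝓢(E, ℂ)) (T : 𝓢'(E, ℂ)) (J : ℕ) :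
    TemperedDistribution.fourierMultiplierCLM ℂ (dilate φ J) T =
      ∑ j ∈ Finset.range (J + 1),
        TemperedDistribution.fourierMultiplierCLM ℂ (dyadicPiece φ j) T := by
  induction J with
  | zero => rw [Finset.sum_range_one, fourierMultiplierCLM_dyadicPiece_zero]
  | succ J ih =>
    rw [Finset.sum_range_succ, ← ih, fourierMultiplierCLM_dyadicPiece_succ, add_sub_cancel]

theorem fourierMultiplierCLM_dilate_dyadicPiece {φ : 𝓢(E, ℂ)} (hφ : IsDyadicGenerator φ)
    (T : 𝓢'(E, ℂ)) (j : ℕ) :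
    TemperedDistribution.fourierMultiplierCLM ℂ (dilate φ (j + 1))
        (TemperedDistribution.fourierMultiplierCLM ℂ (dyadicPiece φ j) T) =
      TemperedDistribution.fourierMultiplierCLM ℂ (dyadicPiece φ j) T := by
  rw [TemperedDistribution.fourierMultiplierCLM_fourierMultiplierCLM_apply
    (hasTemperateGrowth_dyadicPiece φ j) (dilate φ (j + 1)).hasTemperateGrowth,
    dyadicPiece_mul_dilate hφ]

end Decomposition

end BlockRadial

/-! ### The Besov norm bounds moduli of continuity -/

namespace BlockRadial

section Reconstruction

open scoped FourierTransform
open Filter Topology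

theorem le_eLpNorm_count (β : ℕ → ℝ≥0∞) {q : ℝ≥0∞} (hq : 0 < q) (j : ℕ) :
    β j ≤ eLpNorm β q Measure.count := by
  by_cases hq' : q = ∞
  · subst hq'
    rw [eLpNorm_exponent_top, eLpNormEssSup_count]
    exact le_iSup (fun j => ‖β j‖ₑ) j
  · have hp : 0 < q.toReal := ENNReal.toReal_pos hq.ne' hq'
    rw [eLpNorm_eq_lintegral_rpow_enorm_toReal hq.ne' hq', lintegral_count]
    calc β j = (β j ^ q.toReal) ^ (1 / q.toReal) := by
          rw [← ENNReal.rpow_mul, mul_one_div_cancel hp.ne', ENNReal.rpow_one]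
      _ ≤ _ := by
          gcongr
          exact ENNReal.le_tsum (f := fun j => ‖β j‖ₑ ^ q.toReal) j

theorem two_rpow_le_pow_dist_mul {s : ℝ} (k j : ℕ) (h : k ≤ j) :
    (2 : ℝ≥0∞) ^ ((k : ℝ) * s) ≤
      ((2 : ℝ≥0∞) ^ (-(min s (1 - s)))) ^ Nat.dist k j * 2 ^ ((j : ℝ) * s) := by
  rw [Nat.dist_eq_sub_of_le h, ← ENNReal.rpow_natCast, ← ENNReal.rpow_mul,
    ← ENNReal.rpow_add _ _ (by simp) (by simp)]
  refine ENNReal.rpow_le_rpow_of_exponent_le (by norm_num) ?_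
  rw [Nat.cast_sub h]
  have h1 : (k : ℝ) ≤ j := by exact_mod_cast h
  have h2 := mul_le_mul_of_nonneg_right (min_le_left s (1 - s)) (sub_nonneg.mpr h1)
  nlinarith

theorem two_rpow_mul_le_pow_dist_mul {s : ℝ} (k j : ℕ) (h : j ≤ k) :
    (2 : ℝ≥0∞) ^ ((k : ℝ) * s) * 2 ^ ((j : ℝ) - k) ≤
      ((2 : ℝ≥0∞) ^ (-(min s (1 - s)))) ^ Nat.dist k j * 2 ^ ((j : ℝ) * s) := by
  rw [Nat.dist_eq_sub_of_le_right h, ← ENNReal.rpow_natCast, ← ENNReal.rpow_mul,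
    ← ENNReal.rpow_add _ _ (by simp) (by simp), ← ENNReal.rpow_add _ _ (by simp) (by simp)]
  refine ENNReal.rpow_le_rpow_of_exponent_le (by norm_num) ?_
  rw [Nat.cast_sub h]
  have h1 : (j : ℝ) ≤ k := by exact_mod_cast h
  have h2 := mul_le_mul_of_nonneg_right (min_le_right s (1 - s)) (sub_nonneg.mpr h1)
  nlinarith

/-- A uniformly convergent series of functions, the `j`-th of which has size `b_j` and oscillates
at the frequency `2^j`, has moduli of continuity in the weighted sequence space of `(b_j)`. Both
`s > 0` and `s < 1` are needed: the former for the terms with `j ≥ k`, which are estimated by their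
size, the latter for the terms with `j < k`, which are estimated by their Lipschitz constants. -/
theorem two_rpow_mul_dyadicModulus_tsum_le {E : Type*} [NormedAddCommGroup E] (s : ℝ)
    {f : ℕ → E → ℂ} {b : ℕ → ℝ≥0∞} {A : ℝ≥0∞} (hf : ∀ x, Summable fun j => f j x)
    (h1 : ∀ j x, ‖f j x‖ₑ ≤ A * b j)
    (h2 : ∀ (j k : ℕ) x y, ‖x - y‖ ≤ ((2 : ℝ) ^ k)⁻¹ →
      ‖f j x - f j y‖ₑ ≤ A * (2 ^ ((j : ℝ) - k) * b j)) (k : ℕ) :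
    (2 : ℝ≥0∞) ^ ((k : ℝ) * s) * dyadicModulus (fun x => ∑' j, f j x) k ≤
      (2 * A) * ∑' j, ((2 : ℝ≥0∞) ^ (-(min s (1 - s)))) ^ Nat.dist k j *
        (2 ^ ((j : ℝ) * s) * b j) := by
  set ρ : ℝ≥0∞ := (2 : ℝ≥0∞) ^ (-(min s (1 - s))) with hρ
  cases k with
  | zero =>
    rw [Nat.cast_zero, zero_mul, ENNReal.rpow_zero, one_mul]
    refine iSup_le fun x => enorm_tsum_le_tsum_enorm.trans ?_
    rw [← ENNReal.tsum_mul_left]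
    refine ENNReal.tsum_le_tsum fun j => (h1 j x).trans ?_
    have h3 := two_rpow_le_pow_dist_mul (s := s) 0 j (Nat.zero_le j)
    rw [Nat.cast_zero, zero_mul, ENNReal.rpow_zero, ← hρ] at h3
    calc A * b j = 1 * A * (1 * b j) := by ring
      _ ≤ 2 * A * (ρ ^ Nat.dist 0 j * 2 ^ ((j : ℝ) * s) * b j) := by
        gcongr
        exact one_le_two
      _ = _ := by ring
  | succ k =>
    simp only [dyadicModulus, ENNReal.mul_iSup]
    refine iSup_le fun x => iSup_le fun y => iSup_le fun hxy => ?_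
    rw [← (hf x).tsum_sub (hf y)]
    refine (mul_le_mul_right enorm_tsum_le_tsum_enorm _).trans ?_
    rw [← ENNReal.tsum_mul_left, ← ENNReal.tsum_mul_left]
    refine ENNReal.tsum_le_tsum fun j => ?_
    rcases le_total (k + 1) j with hk | hk
    · calc (2 : ℝ≥0∞) ^ (((k + 1 : ℕ) : ℝ) * s) * ‖f j x - f j y‖ₑ
          ≤ (ρ ^ Nat.dist (k + 1) j * 2 ^ ((j : ℝ) * s)) * (A * b j + A * b j) := by
            gcongr
            · exact two_rpow_le_pow_dist_mul (k + 1) j hk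
            · exact enorm_sub_le.trans (add_le_add (h1 j x) (h1 j y))
        _ = _ := by ring
    · calc (2 : ℝ≥0∞) ^ (((k + 1 : ℕ) : ℝ) * s) * ‖f j x - f j y‖ₑ
          ≤ (2 : ℝ≥0∞) ^ (((k + 1 : ℕ) : ℝ) * s) *
              (A * (2 ^ ((j : ℝ) - (k + 1 : ℕ)) * b j)) := by
            gcongr
            exact h2 j (k + 1) x y hxy
        _ = 1 * A * (((2 : ℝ≥0∞) ^ (((k + 1 : ℕ) : ℝ) * s) *
              2 ^ ((j : ℝ) - (k + 1 : ℕ))) * b j) := by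
            ring
        _ ≤ 2 * A * ((ρ ^ Nat.dist (k + 1) j * 2 ^ ((j : ℝ) * s)) * b j) := by
            have h3 := two_rpow_mul_le_pow_dist_mul (s := s) (k + 1) j hk
            gcongr ?_ * A * (?_ * b j)
            exact one_le_two
        _ = _ := by ring

variable {E : Type*} [NormedAddCommGroup E] [InnerProductSpace ℝ E] [FiniteDimensional ℝ E]
  [MeasurableSpace E] [BorelSpace E]

/-- A tempered distribution whose dyadic pieces are bounded functions with summable bounds is
represented by the sum of its pieces. -/
theorem represents_tsum_dyadicPiece {φ : 𝓢(E, ℂ)} (hφ : IsDyadicGenerator φ) {T : 𝓢'(E, ℂ)}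
    {f : ℕ → E → ℂ} {a : ℕ → ℝ} (ha : Summable a) (cf : ∀ j, Continuous (f j))
    (hfa : ∀ j x, ‖f j x‖ ≤ a j)
    (hf : ∀ j, Represents (f j)
      (TemperedDistribution.fourierMultiplierCLM ℂ (dyadicPiece φ j) T)) :
    Represents (fun x => ∑' j, f j x) T := by
  have cF : Continuous fun x => ∑' j, f j x := continuous_tsum cf ha hfa
  have hF : ∀ x, ‖∑' j, f j x‖ ≤ ∑' j, a j := fun x =>
    tsum_of_norm_bounded ha.hasSum fun j => hfa j x
  refine ⟨cF.aestronglyMeasurable, fun u => ⟨integrable_schwartz_mul u cF.aestronglyMeasurable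
    (Eventually.of_forall hF), ?_⟩⟩
  have hint : ∀ j, Integrable (fun x => u x * f j x) volume := fun j => ((hf j).2 u).1
  have hsum : Summable fun j => ∫ x, ‖u x * f j x‖ := by
    refine Summable.of_nonneg_of_le (fun j => integral_nonneg fun x => norm_nonneg _) (fun j => ?_)
      (ha.mul_left (∫ x, ‖u x‖))
    rw [← integral_mul_const]
    refine integral_mono (hint j).norm (u.integrable.norm.mul_const _) fun x => ?_
    simp only [norm_mul]
    gcongr
    exact hfa j x
  have h1 := (hasSum_integral_of_summable_integral_norm hint hsum).tendsto_sum_nat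
  have h2 := (tendsto_fourierMultiplierCLM_dilate hφ T u)
  have e : ∀ J, TemperedDistribution.fourierMultiplierCLM ℂ (dilate φ J) T u =
      ∑ j ∈ Finset.range (J + 1), ∫ x, u x * f j x := fun J => by
    rw [fourierMultiplierCLM_dilate_eq_sum, ((Represents.sum _ fun j _ => hf j).2 u).2]
    rw [← integral_finsetSum _ fun j _ => hint j]
    simp only [Finset.sum_apply, Finset.mul_sum]
  simp only [e] at h2
  rw [tendsto_nhds_unique h2 (h1.comp (tendsto_add_atTop_nat 1))]
  simp only [tsum_mul_left]

/-- For `0 < s < 1`, elements of `B^s_{∞,q}` are bounded continuous functions, whose moduli of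
continuity are controlled by the Besov norm. -/
theorem exists_continuous_represents_modulusNorm_le {φ : 𝓢(E, ℂ)} (hφ : IsDyadicGenerator φ)
    {w : E → ℝ≥0∞} (hw : (volume : Measure E) ≪ volume.withDensity w) {s : ℝ} (hs0 : 0 < s)
    (hs1 : s < 1) {q : ℝ≥0∞} (hq : 0 < q) :
    ∃ C : ℝ≥0, ∀ T : 𝓢'(E, ℂ), besovNorm φ w s ∞ q T < ∞ →
      ∃ F : E → ℂ, Continuous F ∧ (∃ M, ∀ x, ‖F x‖ ≤ M) ∧ Represents F T ∧
        modulusNorm s q F ≤ C * besovNorm φ w s ∞ q T := by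
  set A : ℝ := ∫ z, ‖(𝓕⁻ φ : 𝓢(E, ℂ)) z‖ with hA
  set D : ℝ := ∫ z, ‖fderiv ℝ (𝓕⁻ φ : 𝓢(E, ℂ)) z‖ with hD
  have hA0 : 0 ≤ A := integral_nonneg fun z => norm_nonneg _
  have hD0 : 0 ≤ D := integral_nonneg fun z => norm_nonneg _
  have hρ : (2 : ℝ≥0∞) ^ (-(min s (1 - s))) < 1 :=
    ENNReal.rpow_lt_one_of_one_lt_of_neg (by norm_num)
      (neg_neg_of_pos (lt_min hs0 (sub_pos.mpr hs1)))
  obtain ⟨C, hC⟩ := exists_eLpNorm_tsum_pow_dist_le hρ hq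
  refine ⟨2 * (A + 2 * D).toNNReal * C, fun T hT => ?_⟩
  set b : ℕ → ℝ≥0∞ := fun j =>
    distLpNorm w ∞ (TemperedDistribution.fourierMultiplierCLM ℂ (dyadicPiece φ j) T) with hb
  set N := besovNorm φ w s ∞ q T with hN
  have hbN : ∀ j : ℕ, (2 : ℝ≥0∞) ^ ((j : ℝ) * s) * b j ≤ N := fun j =>
    le_eLpNorm_count (fun j : ℕ => (2 : ℝ≥0∞) ^ ((j : ℝ) * s) * b j) hq j
  have hbN' : ∀ j : ℕ, b j ≤ ((2 : ℝ≥0∞) ^ (-s)) ^ j * N := fun j => by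
    calc b j = 2 ^ (-s * j) * (2 ^ ((j : ℝ) * s) * b j) := by
          rw [← mul_assoc, ← ENNReal.rpow_add _ _ (by simp) (by simp),
            show -s * j + j * s = 0 by ring, ENNReal.rpow_zero, one_mul]
      _ ≤ 2 ^ (-s * j) * N := by
          gcongr
          exact hbN j
      _ = _ := by rw [ENNReal.rpow_mul, ENNReal.rpow_natCast]
  have h2s : (2 : ℝ≥0∞) ^ (-s) < 1 :=
    ENNReal.rpow_lt_one_of_one_lt_of_neg (by norm_num) (neg_neg_of_pos hs0)
  have hbsum : ∑' j, b j ≠ ∞ := by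
    refine ne_top_of_le_ne_top ?_ (ENNReal.tsum_le_tsum hbN')
    rw [ENNReal.tsum_mul_right, ENNReal.tsum_geometric]
    exact ENNReal.mul_ne_top (ENNReal.inv_ne_top.mpr (tsub_pos_of_lt h2s).ne') hT.ne
  have hbt : ∀ j, b j ≠ ∞ := fun j => ENNReal.ne_top_of_tsum_ne_top hbsum j
  have hbsum' : Summable fun j => (b j).toReal := ENNReal.summable_toReal hbsum
  choose G hG hGb using fun j =>
    exists_represents_of_distLpNorm_lt_top hw (lt_top_iff_ne_top.mpr (hbt j))
  set f : ℕ → E → ℂ := fun j => lowPass φ (j + 1) (G j) with hf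
  have hfr : ∀ j, Represents (f j)
      (TemperedDistribution.fourierMultiplierCLM ℂ (dyadicPiece φ j) T) := fun j => by
    rw [← fourierMultiplierCLM_dilate_dyadicPiece hφ T j]
    exact (hG j).lowPass (hGb j) φ (j + 1)
  have cf : ∀ j, Continuous (f j) := fun j => continuous_lowPass φ (j + 1) (hG j).1 (hGb j)
  have hfb : ∀ j x, ‖f j x‖ ≤ A * (b j).toReal := fun j x =>
    norm_lowPass_le φ (j + 1) (hGb j) x
  have ha : Summable fun j => A * (b j).toReal := hbsum'.mul_left A
  refine ⟨fun x => ∑' j, f j x, continuous_tsum cf ha hfb,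
    ⟨_, fun x => tsum_of_norm_bounded ha.hasSum fun j => hfb j x⟩,
    represents_tsum_dyadicPiece hφ ha cf hfb hfr, ?_⟩
  have hC2 : 2 * ((A + 2 * D).toNNReal : ℝ≥0∞) = ((2 * (A + 2 * D).toNNReal : ℝ≥0) : ℝ≥0∞) := by
    push_cast
    rfl
  have key := two_rpow_mul_dyadicModulus_tsum_le s (f := f) (b := b)
    (A := ((A + 2 * D).toNNReal : ℝ≥0∞))
    (fun x => Summable.of_norm_bounded ha fun j => hfb j x) ?_ ?_
  · rw [hC2] at key
    refine (eLpNorm_count_le_mul key q).trans ?_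
    rw [ENNReal.coe_mul (2 * (A + 2 * D).toNNReal), mul_assoc]
    exact mul_le_mul_right (hC _) _
  · intro j x
    calc ‖f j x‖ₑ ≤ ENNReal.ofReal ((A + 2 * D) * (b j).toReal) := by
          rw [← ofReal_norm]
          refine ENNReal.ofReal_le_ofReal ((hfb j x).trans ?_)
          gcongr
          linarith
      _ = _ := by
          rw [ENNReal.ofReal_mul (by positivity), ENNReal.ofReal_toReal (hbt j)]
          rfl
  · intro j k x y hxy
    have e2 : (2 : ℝ≥0∞) ^ ((j : ℝ) - k) = ENNReal.ofReal (2 ^ j * (2 ^ k)⁻¹) := by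
      rw [ENNReal.rpow_sub _ _ (by simp) (by simp), ENNReal.rpow_natCast, ENNReal.rpow_natCast,
        ENNReal.ofReal_mul (by positivity), ENNReal.ofReal_inv_of_pos (by positivity),
        ENNReal.ofReal_pow (by norm_num), ENNReal.ofReal_pow (by norm_num), div_eq_mul_inv]
      norm_num
    calc ‖f j x - f j y‖ₑ
        ≤ ENNReal.ofReal ((A + 2 * D) * ((2 ^ j * (2 ^ k)⁻¹) * (b j).toReal)) := by
          rw [← ofReal_norm]
          refine ENNReal.ofReal_le_ofReal
            ((norm_lowPass_sub_le φ (j + 1) (hG j).1 (hGb j) x y).trans ?_)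
          rw [← hD]
          change D * (2 ^ (j + 1) * ‖x - y‖) * (b j).toReal ≤ _
          calc D * (2 ^ (j + 1) * ‖x - y‖) * (b j).toReal
              ≤ D * (2 ^ (j + 1) * (2 ^ k)⁻¹) * (b j).toReal := by gcongr
            _ = 2 * D * ((2 ^ j * (2 ^ k)⁻¹) * (b j).toReal) := by ring
            _ ≤ _ := by
              gcongr
              linarith
      _ = _ := by
          rw [ENNReal.ofReal_mul (by positivity), ENNReal.ofReal_mul (by positivity), ← e2,
            ENNReal.ofReal_toReal (hbt j)]
          rfl

end Reconstruction

end BlockRadial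

/-! ### Block rotations, block radii and the plane `H_γ` -/

namespace BlockRadial

section Rotations

open Matrix

/-- The Householder reflection exchanging `v` and `(|v|, 0, …, 0)`. -/
theorem exists_orthogonal_mulVec_eq {n : ℕ} (v : Fin (n + 1) → ℝ) :
    ∃ U ∈ Matrix.orthogonalGroup (Fin (n + 1)) ℝ,
      U *ᵥ v = fun k : Fin (n + 1) => if (k : ℕ) = 0 then √(∑ k, v k ^ 2) else 0 := by
  set R := √(∑ k, v k ^ 2) with hR
  have hR2 : v ⬝ᵥ v = R ^ 2 := by
    rw [hR, Real.sq_sqrt (Finset.sum_nonneg fun k _ => sq_nonneg _)]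
    simp [dotProduct, sq]
  set e : Fin (n + 1) → ℝ := fun k => if (k : ℕ) = 0 then R else 0 with he
  have hev : e ⬝ᵥ v = R * v 0 := by
    simp [he, dotProduct]
  have hee : e ⬝ᵥ e = R ^ 2 := by
    simp [he, dotProduct, sq]
  set u := v - e with hu
  have hve : v ⬝ᵥ e = R * v 0 := by rw [dotProduct_comm, hev]
  have huu : u ⬝ᵥ u = 2 * (R ^ 2 - R * v 0) := by
    rw [hu, sub_dotProduct, dotProduct_sub, dotProduct_sub, hR2, hev, hve, hee]
    ring
  have huv : u ⬝ᵥ v = R ^ 2 - R * v 0 := by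
    rw [hu, sub_dotProduct, hR2, hev]
  by_cases h0 : u = 0
  · exact ⟨1, one_mem _, by rw [one_mulVec]; exact sub_eq_zero.mp h0⟩
  · have hc : R ^ 2 - R * v 0 ≠ 0 := fun h =>
      h0 (dotProduct_self_eq_zero.mp (by rw [huu, h, mul_zero]))
    -- the reflection in the hyperplane orthogonal to `u` is `1 - c u uᵀ` with `c = 2 / |u|²`
    set c := (R ^ 2 - R * v 0)⁻¹ with hcdef
    refine ⟨1 - c • vecMulVec u u, ?_, ?_⟩
    · rw [mem_orthogonalGroup_iff, transpose_sub, transpose_one, transpose_smul,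
        transpose_vecMulVec, sub_mul, mul_sub, mul_sub, one_mul, mul_one, one_mul,
        smul_mul_smul_comm, vecMulVec_mul_vecMulVec, huu, vecMulVec_smul, smul_smul]
      have : c * c * (2 * (R ^ 2 - R * v 0)) = c + c := by
        rw [hcdef]; field_simp; ring
      rw [this, add_smul]
      abel
    · rw [sub_mulVec, one_mulVec, smul_mulVec, vecMulVec_mulVec, huv]
      ext k
      have : c * (R ^ 2 - R * v 0) = 1 := inv_mul_cancel₀ hc
      simp only [Pi.sub_apply, Pi.smul_apply, MulOpposite.smul_eq_mul_unop, MulOpposite.unop_op,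
        smul_eq_mul, hu]
      linear_combination (e k - v k) * this

/-- For `n ≥ 2`, every vector is mapped by a rotation to a nonnegative multiple of the first unit
vector. -/
theorem exists_specialOrthogonal_mulVec_eq {n : ℕ} (hn : 2 ≤ n) (v : Fin n → ℝ) :
    ∃ g : Matrix.specialOrthogonalGroup (Fin n) ℝ,
      (g : Matrix (Fin n) (Fin n) ℝ) *ᵥ v =
        fun k : Fin n => if (k : ℕ) = 0 then √(∑ k, v k ^ 2) else 0 := by
  obtain ⟨n, rfl⟩ : ∃ k, n = k + 2 := ⟨n - 2, by omega⟩
  obtain ⟨U, hU, hUv⟩ := exists_orthogonal_mulVec_eq v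
  have hdet : U.det = 1 ∨ U.det = -1 := by
    have h := congrArg Matrix.det ((mem_orthogonalGroup_iff _ _).mp hU)
    rw [det_mul, det_transpose, det_one] at h
    exact mul_self_eq_one_iff.mp h
  rcases hdet with h | h
  · exact ⟨⟨U, mem_specialOrthogonalGroup_iff.mpr ⟨hU, h⟩⟩, hUv⟩
  · -- compose with the reflection in the second coordinate, which fixes the first axis
    set D : Matrix (Fin (n + 2)) (Fin (n + 2)) ℝ :=
      diagonal fun k => if k = 1 then -1 else 1 with hD
    have hDm : D ∈ Matrix.orthogonalGroup (Fin (n + 2)) ℝ := by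
      rw [mem_orthogonalGroup_iff, hD, diagonal_transpose, diagonal_mul_diagonal, ← diagonal_one]
      congr 1
      ext k
      split_ifs <;> simp
    have hDd : D.det = -1 := by
      rw [hD, det_diagonal, Finset.prod_ite_eq']
      simp
    refine ⟨⟨D * U, mem_specialOrthogonalGroup_iff.mpr ⟨mul_mem hDm hU, ?_⟩⟩, ?_⟩
    · rw [det_mul, hDd, h]
      norm_num
    · change (D * U) *ᵥ v = _
      rw [← mulVec_mulVec, hUv, hD]
      ext k
      rw [mulVec_diagonal]
      by_cases hk : k = 1 <;> simp [hk]

end Rotations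

section Blocks

variable {m : ℕ} (γ : Fin m → ℕ)

theorem blockRadii_apply (x : BlockSpace γ) (i : Fin m) :
    blockRadii γ x i = √(∑ k, x ⟨i, k⟩ ^ 2) :=
  rfl

theorem toPlane_apply (r : EuclideanSpace ℝ (Fin m)) (i : Fin m) (k : Fin (γ i)) :
    toPlane γ r ⟨i, k⟩ = if (k : ℕ) = 0 then r i else 0 :=
  rfl

theorem sum_ite_val_eq_zero {n : ℕ} (hn : 0 < n) (a : ℝ) :
    ∑ k : Fin n, (if (k : ℕ) = 0 then a else 0) = a := by
  obtain ⟨n, rfl⟩ : ∃ k, n = k + 1 := ⟨n - 1, by omega⟩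
  simp

theorem norm_toPlane_sub_le (r r' : EuclideanSpace ℝ (Fin m)) :
    ‖toPlane γ r - toPlane γ r'‖ ≤ ‖r - r'‖ := by
  rw [EuclideanSpace.norm_eq, EuclideanSpace.norm_eq]
  refine Real.sqrt_le_sqrt ?_
  rw [Fintype.sum_sigma]
  refine Finset.sum_le_sum fun i _ => ?_
  have e : ∀ k : Fin (γ i), ‖(toPlane γ r - toPlane γ r') ⟨i, k⟩‖ ^ 2 =
      if (k : ℕ) = 0 then ‖(r - r') i‖ ^ 2 else 0 := fun k => by
    rw [PiLp.sub_apply, PiLp.sub_apply, toPlane_apply, toPlane_apply]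
    split_ifs <;> simp
  simp only [e]
  rcases Nat.eq_zero_or_pos (γ i) with h | h
  · have : IsEmpty (Fin (γ i)) := by rw [h]; infer_instance
    rw [Finset.univ_eq_empty, Finset.sum_empty]
    positivity
  · exact (sum_ite_val_eq_zero h _).le

theorem norm_blockRadii_sub_le (x y : BlockSpace γ) :
    ‖blockRadii γ x - blockRadii γ y‖ ≤ ‖x - y‖ := by
  rw [EuclideanSpace.norm_eq, EuclideanSpace.norm_eq]
  refine Real.sqrt_le_sqrt ?_
  rw [Fintype.sum_sigma]
  refine Finset.sum_le_sum fun i _ => ?_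
  let b : BlockSpace γ → EuclideanSpace ℝ (Fin (γ i)) := fun z => WithLp.toLp 2 fun k => z ⟨i, k⟩
  have hb : ∀ z, blockRadii γ z i = ‖b z‖ := fun z => by
    rw [EuclideanSpace.norm_eq, blockRadii_apply]
    simp [b]
  have hs : ∑ k, ‖(x - y) ⟨i, k⟩‖ ^ 2 = ‖b x - b y‖ ^ 2 := by
    rw [EuclideanSpace.norm_sq_eq]
    rfl
  rw [hs, PiLp.sub_apply, hb, hb, Real.norm_eq_abs]
  gcongr
  exact abs_norm_sub_norm_le _ _

theorem continuous_toPlane : Continuous (toPlane γ) :=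
  (LipschitzWith.of_dist_le_mul (K := 1) fun x y => by
    simpa [dist_eq_norm] using norm_toPlane_sub_le γ x y).continuous

theorem continuous_blockRadii : Continuous (blockRadii γ) :=
  (LipschitzWith.of_dist_le_mul (K := 1) fun x y => by
    simpa [dist_eq_norm] using norm_blockRadii_sub_le γ x y).continuous

theorem blockRadii_toPlane {γ : Fin m → ℕ} (hγ : ∀ i, 0 < γ i) (r : EuclideanSpace ℝ (Fin m)) :
    blockRadii γ (toPlane γ r) = WithLp.toLp 2 fun i => |r i| := by
  ext i
  rw [blockRadii_apply]
  simp only [toPlane_apply, ite_pow, ne_eq, OfNat.ofNat_ne_zero, not_false_eq_true, zero_pow]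
  rw [sum_ite_val_eq_zero (hγ i), Real.sqrt_sq_eq_abs]

open Matrix in
theorem sum_sq_mulVec_orthogonal {n : ℕ} (g : Matrix.specialOrthogonalGroup (Fin n) ℝ)
    (v : Fin n → ℝ) :
    ∑ k, ((g : Matrix (Fin n) (Fin n) ℝ) *ᵥ v) k ^ 2 = ∑ k, v k ^ 2 := by
  have h := (mem_orthogonalGroup_iff' _ _).mp (mem_specialOrthogonalGroup_iff.mp g.2).1
  have e : ∀ w : Fin n → ℝ, ∑ k, w k ^ 2 = w ⬝ᵥ w := fun w => by simp [dotProduct, sq]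
  rw [e, e, dotProduct_mulVec, vecMul_mulVec, h, vecMul_one]

variable {γ}

theorem blockRadii_apply_of_mem_blockRotations {A : BlockSpace γ ≃ₗᵢ[ℝ] BlockSpace γ}
    (hA : A ∈ blockRotations γ) (x : BlockSpace γ) : blockRadii γ (A x) = blockRadii γ x := by
  obtain ⟨g, hg⟩ := hA
  ext i
  rw [blockRadii_apply, blockRadii_apply]
  simp only [hg]
  exact congrArg _ (sum_sq_mulVec_orthogonal (g i) fun k => x ⟨i, k⟩)

theorem exists_mem_blockRotations (g : ∀ i : Fin m, Matrix.specialOrthogonalGroup (Fin (γ i)) ℝ) :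
    ∃ A ∈ blockRotations γ, ∀ (x : BlockSpace γ) (i : Fin m) (k : Fin (γ i)),
      A x ⟨i, k⟩ = ∑ l, (g i : Matrix (Fin (γ i)) (Fin (γ i)) ℝ) k l * x ⟨i, l⟩ := by
  let L : BlockSpace γ →ₗ[ℝ] BlockSpace γ :=
    { toFun := fun x => WithLp.toLp 2 fun ik =>
        ∑ l, (g ik.1 : Matrix (Fin (γ ik.1)) (Fin (γ ik.1)) ℝ) ik.2 l * x ⟨ik.1, l⟩
      map_add' := fun x y => by
        ext ik
        simp [mul_add, Finset.sum_add_distrib]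
      map_smul' := fun c x => by
        ext ik
        simp [Finset.mul_sum, mul_left_comm] }
  have hL : ∀ x, ‖L x‖ = ‖x‖ := fun x => by
    rw [EuclideanSpace.norm_eq, EuclideanSpace.norm_eq, Fintype.sum_sigma, Fintype.sum_sigma]
    congr 1
    refine Finset.sum_congr rfl fun i _ => ?_
    simp only [Real.norm_eq_abs, sq_abs]
    exact sum_sq_mulVec_orthogonal (g i) fun k => x ⟨i, k⟩
  exact ⟨(LinearIsometry.mk L hL).toLinearIsometryEquiv rfl, ⟨g, fun x i k => rfl⟩,
    fun x i k => rfl⟩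

/-- Every block rotation orbit meets the plane `H_γ` in the point given by the block radii. -/
theorem exists_blockRotation_eq_toPlane (hγ : ∀ i, 2 ≤ γ i) (x : BlockSpace γ) :
    ∃ A ∈ blockRotations γ, A x = toPlane γ (blockRadii γ x) := by
  choose g hg using fun i => exists_specialOrthogonal_mulVec_eq (hγ i) fun k => x ⟨i, k⟩
  obtain ⟨A, hA, h⟩ := exists_mem_blockRotations g
  refine ⟨A, hA, ?_⟩
  ext ⟨i, k⟩
  rw [h, toPlane_apply, blockRadii_apply]
  exact congrFun (hg i) k

theorem exists_mem_signChanges (ε : Fin m → ℤˣ) :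
    ∃ A ∈ signChanges m, ∀ (r : EuclideanSpace ℝ (Fin m)) (i : Fin m),
      A r i = ((ε i : ℤ) : ℝ) * r i := by
  let L : EuclideanSpace ℝ (Fin m) →ₗ[ℝ] EuclideanSpace ℝ (Fin m) :=
    { toFun := fun r => WithLp.toLp 2 fun i => ((ε i : ℤ) : ℝ) * r i
      map_add' := fun x y => by
        ext i
        simp [mul_add]
      map_smul' := fun c x => by
        ext i
        simp [mul_left_comm] }
  have hε : ∀ i, |((ε i : ℤ) : ℝ)| = 1 := fun i => by
    rcases Int.units_eq_one_or (ε i) with h | h <;> simp [h]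
  have hL : ∀ x, ‖L x‖ = ‖x‖ := fun x => by
    rw [EuclideanSpace.norm_eq, EuclideanSpace.norm_eq]
    simp [L, hε]
  exact ⟨(LinearIsometry.mk L hL).toLinearIsometryEquiv rfl, ⟨ε, fun r i => rfl⟩, fun r i => rfl⟩

theorem exists_signChange_eq_abs (r : EuclideanSpace ℝ (Fin m)) :
    ∃ A ∈ signChanges m, A r = WithLp.toLp 2 fun i => |r i| := by
  obtain ⟨A, hA, h⟩ := exists_mem_signChanges fun i => if 0 ≤ r i then 1 else -1
  refine ⟨A, hA, ?_⟩
  ext i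
  rw [h]
  split_ifs with hi
  · simp [abs_of_nonneg hi]
  · simp [abs_of_neg (not_le.mp hi)]

theorem abs_apply_of_mem_signChanges {A : EuclideanSpace ℝ (Fin m) ≃ₗᵢ[ℝ] EuclideanSpace ℝ (Fin m)}
    (hA : A ∈ signChanges m) (r : EuclideanSpace ℝ (Fin m)) (i : Fin m) : |A r i| = |r i| := by
  obtain ⟨ε, hε⟩ := hA
  rw [hε, abs_mul]
  rcases Int.units_eq_one_or (ε i) with h | h <;> simp [h]

/-- The weight vanishes only on the coordinate hyperplanes, so that the weighted measure has the
same null sets as Lebesgue measure. -/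
theorem absolutelyContinuous_withDensity_weight (γ : Fin m → ℕ) :
    (volume : Measure (EuclideanSpace ℝ (Fin m))) ≪ volume.withDensity (weight γ) := by
  refine withDensity_absolutelyContinuous' ?_ ?_
  · refine Measurable.aemeasurable (ENNReal.measurable_ofReal.comp (Continuous.measurable ?_))
    fun_prop
  · have h : ∀ i : Fin m, ∀ᵐ r : EuclideanSpace ℝ (Fin m), r i ≠ 0 := fun i => by
      let p : EuclideanSpace ℝ (Fin m) →ₗ[ℝ] ℝ := (EuclideanSpace.proj i : _ →L[ℝ] ℝ)
      have hp : LinearMap.ker p ≠ ⊤ := fun h => by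
        have h1 : EuclideanSpace.single i (1 : ℝ) ∈ LinearMap.ker p := h ▸ Submodule.mem_top
        simp [p] at h1
      refine measure_mono_null (fun r hr => ?_) (Measure.addHaar_submodule volume _ hp)
      simpa [p] using hr
    filter_upwards [ae_all_iff.mpr h] with r hr
    rw [weight, ne_eq, ENNReal.ofReal_eq_zero, not_le]
    exact Finset.prod_pos fun i _ => pow_pos (abs_pos.mpr (hr i)) _

end Blocks

end BlockRadial

/-! ### Traces and extensions -/

namespace BlockRadial

/-- A linear relation that is a bijection is the graph of a linear equivalence. -/
theorem exists_linearEquiv_of_relation {R V W : Type*} [Semiring R] [AddCommMonoid V] [Module R V]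
    [AddCommMonoid W] [Module R W] (r : V → W → Prop)
    (add : ∀ {v v' w w'}, r v w → r v' w' → r (v + v') (w + w'))
    (smul : ∀ (c : R) {v w}, r v w → r (c • v) (c • w))
    (right_unique : ∀ {v w w'}, r v w → r v w' → w = w')
    (left_unique : ∀ {v v' w}, r v w → r v' w → v = v')
    (left_total : ∀ v, ∃ w, r v w) (right_total : ∀ w, ∃ v, r v w) :
    ∃ e : V ≃ₗ[R] W, ∀ v, r v (e v) := by
  choose f hf using left_total
  let L : V →ₗ[R] W :=
    { toFun := f
      map_add' := fun v v' => right_unique (hf _) (add (hf v) (hf v'))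
      map_smul' := fun c v => right_unique (hf _) (smul c (hf v)) }
  refine ⟨LinearEquiv.ofBijective L ⟨fun v v' h => ?_, fun w => ?_⟩, hf⟩
  · have h' : f v = f v' := h
    exact left_unique (hf v) (h' ▸ hf v')
  · obtain ⟨v, hv⟩ := right_total w
    exact ⟨v, right_unique (hf v) hv⟩

section Trace

variable {m : ℕ} (γ : Fin m → ℕ)

/-- The common graph of trace and extension: `f` is represented by a bounded continuous function
`F` that depends on the block radii only, and `g` by the restriction of `F` to `H_γ`. -/
def IsRadialTrace (f : 𝓢'(BlockSpace γ, ℂ)) (g : 𝓢'(EuclideanSpace ℝ (Fin m), ℂ)) : Prop :=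
  ∃ F : BlockSpace γ → ℂ, Continuous F ∧ (∃ M, ∀ x, ‖F x‖ ≤ M) ∧ Represents F f ∧
    Represents (fun r => F (toPlane γ r)) g ∧ ∀ x, F (toPlane γ (blockRadii γ x)) = F x

variable {γ}

theorem IsRadialTrace.add {f f' : 𝓢'(BlockSpace γ, ℂ)} {g g' : 𝓢'(EuclideanSpace ℝ (Fin m), ℂ)}
    (h : IsRadialTrace γ f g) (h' : IsRadialTrace γ f' g') :
    IsRadialTrace γ (f + f') (g + g') := by
  obtain ⟨F, cF, ⟨M, hM⟩, hf, hg, hr⟩ := h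
  obtain ⟨F', cF', ⟨M', hM'⟩, hf', hg', hr'⟩ := h'
  refine ⟨F + F', cF.add cF', ⟨M + M', fun x => ?_⟩, hf.add hf', hg.add hg', fun x => ?_⟩
  · exact (norm_add_le _ _).trans (add_le_add (hM x) (hM' x))
  · rw [Pi.add_apply, Pi.add_apply, hr, hr']

theorem IsRadialTrace.smul (c : ℂ) {f : 𝓢'(BlockSpace γ, ℂ)}
    {g : 𝓢'(EuclideanSpace ℝ (Fin m), ℂ)} (h : IsRadialTrace γ f g) :
    IsRadialTrace γ (c • f) (c • g) := by
  obtain ⟨F, cF, ⟨M, hM⟩, hf, hg, hr⟩ := h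
  refine ⟨c • F, cF.const_smul c, ⟨‖c‖ * M, fun x => ?_⟩, hf.smul c, hg.smul c, fun x => ?_⟩
  · rw [Pi.smul_apply, norm_smul]
    gcongr
    exact hM x
  · rw [Pi.smul_apply, Pi.smul_apply, hr]

theorem IsRadialTrace.right_unique {f : 𝓢'(BlockSpace γ, ℂ)}
    {g g' : 𝓢'(EuclideanSpace ℝ (Fin m), ℂ)} (h : IsRadialTrace γ f g)
    (h' : IsRadialTrace γ f g') : g = g' := by
  obtain ⟨F, cF, -, hf, hg, -⟩ := h
  obtain ⟨F', cF', -, hf', hg', -⟩ := h'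
  obtain rfl := hf.eq_of_continuous hf' cF cF'
  exact hg.dist_ext hg'

theorem IsRadialTrace.left_unique {f f' : 𝓢'(BlockSpace γ, ℂ)}
    {g : 𝓢'(EuclideanSpace ℝ (Fin m), ℂ)} (h : IsRadialTrace γ f g)
    (h' : IsRadialTrace γ f' g) : f = f' := by
  obtain ⟨F, cF, -, hf, hg, hr⟩ := h
  obtain ⟨F', cF', -, hf', hg', hr'⟩ := h'
  have e := hg.eq_of_continuous hg' (cF.comp (continuous_toPlane γ))
    (cF'.comp (continuous_toPlane γ))
  have : F = F' := funext fun x => by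
    rw [← hr x, ← hr' x]
    exact congrFun e (blockRadii γ x)
  subst this
  exact hf.dist_ext hf'

theorem IsRadialTrace.isTrace {f : 𝓢'(BlockSpace γ, ℂ)} {g : 𝓢'(EuclideanSpace ℝ (Fin m), ℂ)}
    (h : IsRadialTrace γ f g) : IsTrace γ f g := by
  obtain ⟨F, cF, -, hf, hg, -⟩ := h
  exact ⟨F, cF, hf, hg⟩

theorem IsRadialTrace.isExtension {f : 𝓢'(BlockSpace γ, ℂ)}
    {g : 𝓢'(EuclideanSpace ℝ (Fin m), ℂ)} (h : IsRadialTrace γ f g) : IsExtension γ g f := by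
  obtain ⟨F, cF, -, hf, hg, hr⟩ := h
  refine ⟨fun r => F (toPlane γ r), cF.comp (continuous_toPlane γ), hg, ?_⟩
  simpa only [hr] using hf

/-- A rotation invariant distribution with a bounded continuous representative has a trace on
`H_γ`, which is invariant under sign changes. -/
theorem exists_isRadialTrace_left (hγ : ∀ i, 2 ≤ γ i) {f : 𝓢'(BlockSpace γ, ℂ)}
    (hf : f ∈ invariantDistributions (blockRotations γ)) {F : BlockSpace γ → ℂ}
    (cF : Continuous F) (hM : ∃ M, ∀ x, ‖F x‖ ≤ M) (hF : Represents F f) :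
    ∃ g ∈ invariantDistributions (signChanges m), IsRadialTrace γ f g := by
  obtain ⟨M, hM⟩ := hM
  have hr : ∀ x, F (toPlane γ (blockRadii γ x)) = F x := fun x => by
    obtain ⟨A, hA, hAx⟩ := exists_blockRotation_eq_toPlane hγ x
    rw [← hAx, apply_eq_of_mem_invariantDistributions hf hF cF hM hA]
  have cG : Continuous fun r => F (toPlane γ r) := cF.comp (continuous_toPlane γ)
  obtain ⟨g, hg⟩ := exists_represents_of_bounded (M := M) cG.aestronglyMeasurable
    (Filter.Eventually.of_forall fun r => hM _)
  refine ⟨g, mem_invariantDistributions_of_apply_eq hg fun A hA r => ?_,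
    F, cF, ⟨M, hM⟩, hF, hg, hr⟩
  have h0 : ∀ i, 0 < γ i := fun i => two_pos.trans_le (hγ i)
  rw [← hr (toPlane γ (A r)), ← hr (toPlane γ r), blockRadii_toPlane h0, blockRadii_toPlane h0]
  simp only [abs_apply_of_mem_signChanges hA]

/-- A distribution on `H_γ` that is invariant under sign changes and has a bounded continuous
representative extends to a rotation invariant distribution. -/
theorem exists_isRadialTrace_right (hγ : ∀ i, 2 ≤ γ i) {g : 𝓢'(EuclideanSpace ℝ (Fin m), ℂ)}
    (hg : g ∈ invariantDistributions (signChanges m)) {G : EuclideanSpace ℝ (Fin m) → ℂ}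
    (cG : Continuous G) (hM : ∃ M, ∀ x, ‖G x‖ ≤ M) (hG : Represents G g) :
    ∃ f ∈ invariantDistributions (blockRotations γ), IsRadialTrace γ f g := by
  obtain ⟨M, hM⟩ := hM
  have cF : Continuous fun x => G (blockRadii γ x) := cG.comp (continuous_blockRadii γ)
  obtain ⟨f, hf⟩ := exists_represents_of_bounded (M := M) cF.aestronglyMeasurable
    (Filter.Eventually.of_forall fun x => hM _)
  have hr : ∀ r, G (blockRadii γ (toPlane γ r)) = G r := fun r => by
    obtain ⟨A, hA, hAr⟩ := exists_signChange_eq_abs r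
    rw [blockRadii_toPlane fun i => two_pos.trans_le (hγ i), ← hAr,
      apply_eq_of_mem_invariantDistributions hg hG cG hM hA]
  refine ⟨f, mem_invariantDistributions_of_apply_eq hf fun A hA x => ?_,
    _, cF, ⟨M, fun x => hM _⟩, hf, ?_, fun x => hr _⟩
  · rw [blockRadii_apply_of_mem_blockRotations hA]
  · simpa only [hr] using hG

/-- The trace is bounded because the embedding of `H_γ` is nonexpansive. -/
theorem exists_besovNorm_trace_le {φ : 𝓢(BlockSpace γ, ℂ)} (hφ : IsDyadicGenerator φ)
    {ψ : 𝓢(EuclideanSpace ℝ (Fin m), ℂ)} (hψ : IsDyadicGenerator ψ) {s : ℝ} (hs0 : 0 < s)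
    (hs1 : s < 1) {q : ℝ≥0∞} (hq : 0 < q) :
    ∃ C : ℝ≥0, ∀ f g, IsRadialTrace γ f g → besovNorm φ (fun _ => 1) s ∞ q f < ∞ →
      besovNorm ψ (weight γ) s ∞ q g ≤ C * besovNorm φ (fun _ => 1) s ∞ q f := by
  obtain ⟨C₁, hC₁⟩ := exists_continuous_represents_modulusNorm_le hφ (w := fun _ => 1)
    (withDensity_one.symm ▸ Measure.AbsolutelyContinuous.rfl) hs0 hs1 hq
  obtain ⟨C₂, hC₂⟩ := exists_besovNorm_le_modulusNorm hψ (weight γ) s q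
  refine ⟨C₂ * C₁, fun f g h hfin => ?_⟩
  obtain ⟨F, cF, ⟨M, hM⟩, hf, hg, -⟩ := h
  obtain ⟨F', cF', -, hf', hN⟩ := hC₁ f hfin
  obtain rfl := hf.eq_of_continuous hf' cF cF'
  rw [ENNReal.coe_mul, mul_assoc]
  refine (hC₂ _ g (cF.comp (continuous_toPlane γ)) ⟨M, fun r => hM _⟩ hg).trans ?_
  gcongr
  exact (modulusNorm_comp_le s q F (norm_toPlane_sub_le γ)).trans hN

/-- The extension is bounded because the map to the block radii is nonexpansive. -/
theorem exists_besovNorm_extension_le {φ : 𝓢(BlockSpace γ, ℂ)} (hφ : IsDyadicGenerator φ)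
    {ψ : 𝓢(EuclideanSpace ℝ (Fin m), ℂ)} (hψ : IsDyadicGenerator ψ) {s : ℝ} (hs0 : 0 < s)
    (hs1 : s < 1) {q : ℝ≥0∞} (hq : 0 < q) :
    ∃ C : ℝ≥0, ∀ f g, IsRadialTrace γ f g → besovNorm ψ (weight γ) s ∞ q g < ∞ →
      besovNorm φ (fun _ => 1) s ∞ q f ≤ C * besovNorm ψ (weight γ) s ∞ q g := by
  obtain ⟨C₁, hC₁⟩ := exists_continuous_represents_modulusNorm_le hψ
    (absolutelyContinuous_withDensity_weight γ) hs0 hs1 hq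
  obtain ⟨C₂, hC₂⟩ := exists_besovNorm_le_modulusNorm hφ (fun _ => 1) s q
  refine ⟨C₂ * C₁, fun f g h hfin => ?_⟩
  obtain ⟨F, cF, hM, hf, hg, hr⟩ := h
  obtain ⟨G, cG, -, hg', hN⟩ := hC₁ g hfin
  obtain rfl := hg'.eq_of_continuous hg cG (cF.comp (continuous_toPlane γ))
  rw [ENNReal.coe_mul, mul_assoc]
  refine (hC₂ F f cF hM hf).trans ?_
  gcongr
  refine le_trans ?_ hN
  simpa only [hr] using modulusNorm_comp_le s q (fun r => F (toPlane γ r))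
    (norm_blockRadii_sub_le γ)

end Trace

end BlockRadial

theorem proposition2p4 {m : ℕ} (γ : Fin m → ℕ) (hγ : ∀ i, 2 ≤ γ i) (hd : 2 ≤ ∑ i, γ i)
    (s : ℝ) (hs0 : 0 < s) (hs1 : s < 1) (q : ℝ≥0∞) (hq : 0 < q)
    (φ : 𝓢(BlockRadial.BlockSpace γ, ℂ)) (hφ : BlockRadial.IsDyadicGenerator φ)
    (ψ : 𝓢(EuclideanSpace ℝ (Fin m), ℂ)) (hψ : BlockRadial.IsDyadicGenerator ψ) :
    ∃ tr : BlockRadial.blockRadialBesov γ φ s ∞ q ≃ₗ[ℂ]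
        BlockRadial.reflectionInvariantBesov γ ψ s ∞ q,
      (∀ f, BlockRadial.IsTrace γ f.1 (tr f).1) ∧
      (∀ g, BlockRadial.IsExtension γ g.1 (tr.symm g).1) ∧
      ∃ C : ℝ≥0, ∀ f,
        BlockRadial.besovNorm ψ (BlockRadial.weight γ) s ∞ q (tr f).1 ≤
          C * BlockRadial.besovNorm φ (fun _ => 1) s ∞ q f.1 ∧
        BlockRadial.besovNorm φ (fun _ => 1) s ∞ q f.1 ≤
          C * BlockRadial.besovNorm ψ (BlockRadial.weight γ) s ∞ q (tr f).1 := by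
  obtain ⟨C₁, hC₁⟩ := BlockRadial.exists_besovNorm_trace_le hφ hψ hs0 hs1 hq
  obtain ⟨C₂, hC₂⟩ := BlockRadial.exists_besovNorm_extension_le hφ hψ hs0 hs1 hq
  obtain ⟨tr, htr⟩ := BlockRadial.exists_linearEquiv_of_relation (R := ℂ)
    (V := BlockRadial.blockRadialBesov γ φ s ∞ q)
    (W := BlockRadial.reflectionInvariantBesov γ ψ s ∞ q)
    (fun f g => BlockRadial.IsRadialTrace γ f.1 g.1)
    (fun h h' => h.add h') (fun c _ _ h => h.smul c)
    (fun h h' => Subtype.ext (h.right_unique h')) (fun h h' => Subtype.ext (h.left_unique h'))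
    (fun ⟨f, hf, hfin⟩ => by
      obtain ⟨_, hA⟩ := BlockRadial.exists_continuous_represents_modulusNorm_le hφ
        (w := fun _ => 1) (withDensity_one.symm ▸ Measure.AbsolutelyContinuous.rfl) hs0 hs1 hq
      obtain ⟨F, cF, hM, hF, -⟩ := hA f hfin
      obtain ⟨g, hg, h⟩ := BlockRadial.exists_isRadialTrace_left hγ hf cF hM hF
      exact ⟨⟨g, hg, (hC₁ f g h hfin).trans_lt (ENNReal.mul_lt_top ENNReal.coe_lt_top hfin)⟩, h⟩)
    (fun ⟨g, hg, hfin⟩ => by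
      obtain ⟨_, hA⟩ := BlockRadial.exists_continuous_represents_modulusNorm_le hψ
        (BlockRadial.absolutelyContinuous_withDensity_weight γ) hs0 hs1 hq
      obtain ⟨G, cG, hM, hG, -⟩ := hA g hfin
      obtain ⟨f, hf, h⟩ := BlockRadial.exists_isRadialTrace_right hγ hg cG hM hG
      exact ⟨⟨f, hf, (hC₂ f g h hfin).trans_lt (ENNReal.mul_lt_top ENNReal.coe_lt_top hfin)⟩, h⟩)
  refine ⟨tr, fun f => (htr f).isTrace, fun g => ?_, max C₁ C₂, fun f => ⟨?_, ?_⟩⟩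
  · have h := (htr (tr.symm g)).isExtension
    rwa [tr.apply_symm_apply] at h
  · refine (hC₁ f.1 (tr f).1 (htr f) f.2.2).trans ?_
    gcongr
    exact le_max_left _ _
  · refine (hC₂ f.1 (tr f).1 (htr f) (tr f).2.2).trans ?_
    gcongr
    exact le_max_right _ _
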